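/- **Setting.** Let $L$ be a real vector space (germs of solutions on a hypersurface $\Sigma$) with a symplectic form $\omega$ and a positive-definite complex structure $J$: $J^2=-1$, $\omega(J\phi,J\eta)=\omega(\phi,\eta)$ and $\omega(\phi,J\phi)>0$ for $\phi\neq 0$. Put $g(\phi,\eta)=2\omega(\phi,J\eta)$ and $\{\phi,\eta\}=g(\phi,\eta)+2\mathrm i\,\omega(\phi,\eta)$. Extend $\omega$ and $J$ complex linearly to $L^{\mathbb C}=L\oplus\mathrm iL$, let $L^\pm\subseteq L^{\mathbb C}$ be the eigenspaces of $J$ for the eigenvalues $\pm\mathrm i$, and let $P^\pm=\frac12(1\mp\mathrm iJ)$ be the projectors onto them. Let $\mathcal H$ be the Hilbert space of holomorphic wave functions $\psi\colon L\to\mathbb C$, i.e. the Hilbert space of functions on $L$ with reproducing kernel $\langle K_\phi,K_\xi\rangle=\exp(\frac12\{\xi,\phi\})$. It contains the coherent states $K_\xi(\phi)=\exp(\frac12\{\xi,\phi\})$, and $\psi(\phi)=\langle K_\phi,\psi\rangle$. A slice observable is a function $F\colon L^{\mathbb C}\to\mathbb C$ such that $z\mapsto F(a+zb)$ is entire for all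 $a,b\in L^{\mathbb C}$. **Quantization.** For $\xi\in L^{\mathbb C}$ let $D_\xi(\phi)=2\omega(\xi,\phi)$ and $G_\xi=\exp(\mathrm iD_\xi)$ (linear and Weyl observables). The slice region has boundary data $(\tau,\phi)\in L\oplus L$, the second copy having the opposite orientation (symplectic form $\omega\oplus(-\omega)$, complex structure $J\oplus(-J)$). Its interior solutions form the diagonal, and an observable $F$ has on $(\phi_1,\phi_2)$ the value $F(\frac12(\phi_1+\phi_2))$. For Weyl observables the correlation functions on the coherent states $K_\tau\otimes\iota(K_\phi)$ are $$\rho^{G_\xi}(K_\tau\otimes\iota(K_\phi))=\rho(K_\tau\otimes \iota(K_\phi))\;G_\xi(\widehat{(\tau,\phi)})\;\exp\big(\tfrac{\mathrm i}{2}D_\xi(\eta)\big).$$ Here $\widehat\zeta=\zeta^R-\mathrm i\zeta^I$ for the decomposition $\zeta=\zeta^R+(J\oplus(-J))\zeta^I$ of $\zeta=(\tau,\phi)$ with $\zeta^R,\zeta^I$ in the diagonal; $\rho(K_\tau\otimes\iota(K_\phi))=\exp(\frac14\{\zeta,\zeta\}_\partial-\frac{\mathrm i}2g_\partial(\zeta^R,\zeta^I)-\frac12g_\partial(\zeta^I,\zeta^I))$,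 where $g_\partial,\{\cdot,\cdot\}_\partial$ are formed from the boundary structures; and $\eta=(-P^+\xi,P^-\xi)$ is the unique solution with source $D_\xi$ in $L^+\oplus L^-$. Weyl observables generate the other observables, as follows. - For a product of linear observables, $\rho^{D_{\xi_1}\cdots D_{\xi_n}}=(-\mathrm i)^n\partial_{\lambda_1}\cdots\partial_{\lambda_n}\rho^{G_{\lambda_1\xi_1+\cdots+\lambda_n\xi_n}}|_{\lambda=0}$. - For a general observable $F$ and a finite-dimensional $J$-invariant subspace $V\subseteq L$, write each homogeneous Taylor component $F_n$ of $F$ at $0$, restricted to $V^{\mathbb C}$, as a finite linear combination of products of $n$ linear observables $D_\xi$ with $\xi\in V^{\mathbb C}$. Apply the previous rule linearly and sum over $n$ (unconditionally convergent). Then $\rho^F$ is the limit of the result along the set of all such $V$, directed by inclusion. $F$ is *quantizable* if this defines $\rho^F(K_\tau\otimes\iota(K_\phi))$ for all $\tau,\phi\in L$ and, for each $\phi$, $K_\tau\mapsto\rho^F(K_\tau\otimes\iota(K_\phi))$ extends (then uniquely) to a continuous linear functional $\psi\mapsto\rho^F(\psi\otimes\iota(K_\phi))$ on $\mathcal H$.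 For $\psi\in\mathcal H$ the function $\hat F\psi\colon L\to\mathbb C$ is then $$(\hat F\psi)(\phi)=\langle K_\phi,\hat F\psi\rangle=\rho^F(\psi\otimes\iota(K_\phi)).$$ As a (possibly unbounded) operator in $\mathcal H$, $\hat F$ has the domain $\{\psi\in\mathcal H:\hat F\psi\in\mathcal H\}$. **Proposition.** Let the slice observable $F$ be holomorphic with respect to $J$, i.e. $F(\phi)=F(\phi+\xi)$ for all $\phi\in L^{\mathbb C}$ and $\xi\in L^-$. Then $F$ is quantizable, with a unique $\hat F$, and $\hat F$ acts by multiplication of wave functions: $$(\hat F\psi)(\phi)=F(\phi)\,\psi(\phi)\qquad\text{for all }\psi\in\mathcal H,\ \phi\in L.$$ In particular, as an operator in $\mathcal H$, $\hat F$ is multiplication by $F$ on the maximal domain $\{\psi\in\mathcal H: F\psi\in\mathcal H\}$. -/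

import Mathlib

open scoped TensorProduct

noncomputable section

/-- The space of germs of solutions on a hypersurface: a real vector space `L` with a symplectic
form `ω` and a positive-definite complex structure `J`, i.e. a Kähler polarization. No completeness
and no finiteness of the dimension is required. Non-degeneracy of `ω` follows from `pos`. -/
structure KahlerPhaseSpace (L : Type*) [AddCommGroup L] [Module ℝ L] where
  /-- the symplectic form -/
  ω : LinearMap.BilinForm ℝ L
  /-- the complex structure -/
  J : L →ₗ[ℝ] L
  alt : ∀ x, ω x x = 0
  J_sq : ∀ x, J (J x) = -x
  compat : ∀ x y, ω (J x) (J y) = ω x y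
  pos : ∀ x, x ≠ 0 → 0 < ω x (J x)

/-- The complexification `L^ℂ = L ⊕ i L`. -/
abbrev Cx (L : Type*) [AddCommGroup L] [Module ℝ L] : Type _ := ℂ ⊗[ℝ] L

/-- The inclusion `L → L^ℂ` of the real elements. -/
def toCx {L : Type*} [AddCommGroup L] [Module ℝ L] (φ : L) : Cx L := (1 : ℂ) ⊗ₜ[ℝ] φ

/-- Holomorphic functions on a complex vector space (no topology): entire on every complex line. -/
def IsLineHolomorphic {V : Type*} [AddCommGroup V] [Module ℂ V] (f : V → ℂ) : Prop :=
  ∀ a b : V, Differentiable ℂ fun z : ℂ => f (a + z • b)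

theorem Cx.exists_re_im {L : Type*} [AddCommGroup L] [Module ℝ L] (x : Cx L) :
    ∃ a b : L, x = toCx a + Complex.I • toCx b := by
  induction x using TensorProduct.induction_on with
  | zero => exact ⟨0, 0, by simp [toCx]⟩
  | tmul z v =>
    refine ⟨z.re • v, z.im • v, ?_⟩
    simp only [toCx, TensorProduct.tmul_smul, TensorProduct.smul_tmul', ← TensorProduct.add_tmul]
    congr 1
    apply Complex.ext <;> simp
  | add x y hx hy =>
    obtain ⟨a, b, rfl⟩ := hx
    obtain ⟨c, d, rfl⟩ := hy
    refine ⟨a + c, b + d, ?_⟩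
    simp only [toCx, TensorProduct.tmul_add, smul_add]
    abel

namespace KahlerPhaseSpace

variable {L : Type*} [AddCommGroup L] [Module ℝ L] (S : KahlerPhaseSpace L)

theorem skew (x y : L) : S.ω x y = -S.ω y x := by
  have h := S.alt (x + y)
  simp only [map_add, LinearMap.add_apply, S.alt, zero_add, add_zero] at h
  linarith

theorem ω_J_comm (x y : L) : S.ω x (S.J y) = S.ω y (S.J x) := by
  rw [← S.compat x (S.J y), S.J_sq, map_neg, S.skew (S.J x) y, neg_neg]

/-- The real inner product `g(φ, η) = 2 ω(φ, J η)`. -/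
def g (φ η : L) : ℝ := 2 * S.ω φ (S.J η)

/-- The hermitian inner product `{φ, η} = 2 ω(φ, J η) + 2 i ω(φ, η)`; it is antilinear in the first
and linear in the second argument with respect to `J`. -/
def herm (φ η : L) : ℂ := (S.g φ η : ℂ) + 2 * Complex.I * (S.ω φ η : ℂ)

/-- The complex bilinear extension of `ω` to `L^ℂ`. -/
def ωC : LinearMap.BilinForm ℂ (Cx L) := S.ω.baseChange ℂ

/-- The complex linear extension of `J` to `L^ℂ`. -/
def JC : Cx L →ₗ[ℂ] Cx L := S.J.baseChange ℂ

/-- The polarization `L^+`, the `i`-eigenspace of `J` on `L^ℂ`. -/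
def Lplus : Submodule ℂ (Cx L) := Module.End.eigenspace S.JC Complex.I

/-- The conjugate polarization `L^-`, the `(-i)`-eigenspace of `J` on `L^ℂ`. -/
def Lminus : Submodule ℂ (Cx L) := Module.End.eigenspace S.JC (-Complex.I)

/-- The projector onto `L^+`. -/
def Pplus (φ : Cx L) : Cx L := (1 / 2 : ℂ) • (φ - Complex.I • S.JC φ)

/-- The projector onto `L^-`. -/
def Pminus (φ : Cx L) : Cx L := (1 / 2 : ℂ) • (φ + Complex.I • S.JC φ)

/-! ### The state space: Hilbert space of holomorphic wave functions on `L` -/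

theorem herm_conj (x y : L) : (starRingEnd ℂ) (S.herm x y) = S.herm y x := by
  apply Complex.ext
  · simp [herm, g, S.ω_J_comm x y]
  · simp [herm, g, S.skew x y]

/-- Multiplication of an element of `L` by a complex number, where `i` acts as `J`. -/
def cmul (c : ℂ) (x : L) : L := c.re • x + c.im • S.J x

theorem herm_add_left (x y z : L) : S.herm (x + y) z = S.herm x z + S.herm y z := by
  simp [herm, g]; ring

theorem herm_add_right (x y z : L) : S.herm x (y + z) = S.herm x y + S.herm x z := by
  simp [herm, g]; ring

theorem herm_cmul_right (c : ℂ) (x y : L) : S.herm x (S.cmul c y) = c * S.herm x y := by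
  apply Complex.ext
  · simp [herm, g, cmul, S.J_sq]; ring
  · simp [herm, g, cmul, S.J_sq]; ring

theorem herm_cmul_left (c : ℂ) (x y : L) :
    S.herm (S.cmul c x) y = (starRingEnd ℂ) c * S.herm x y := by
  rw [← S.herm_conj y, herm_cmul_right, map_mul, S.herm_conj]

theorem herm_self_re_nonneg (x : L) : 0 ≤ (S.herm x x).re := by
  by_cases h : x = 0
  · simp [h, herm, g]
  · have := S.pos x h
    simp [herm, g]; linarith

theorem herm_self (x : L) : S.herm x x = ((S.herm x x).re : ℂ) := by
  apply Complex.ext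
  · simp
  · simp [herm, S.alt]

theorem herm_sum_left {ι : Type*} (s : Finset ι) (f : ι → L) (y : L) :
    S.herm (∑ i ∈ s, f i) y = ∑ i ∈ s, S.herm (f i) y := by
  classical
  induction s using Finset.induction_on with
  | empty => simp [herm, g]
  | insert a s ha ih => rw [Finset.sum_insert ha, Finset.sum_insert ha, herm_add_left, ih]

theorem herm_sum_right {ι : Type*} (s : Finset ι) (f : ι → L) (y : L) :
    S.herm y (∑ i ∈ s, f i) = ∑ i ∈ s, S.herm y (f i) := by
  classical
  induction s using Finset.induction_on with
  | empty => simp [herm, g]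
  | insert a s ha ih => rw [Finset.sum_insert ha, Finset.sum_insert ha, herm_add_right, ih]

/-- The scalar kernel `(φ, ξ) ↦ exp({ξ, φ} / 2)`: the value at `φ` of the wave function of the
coherent state at `ξ`. -/
def cohScalar (φ ξ : L) : ℂ := Complex.exp (1 / 2 * S.herm ξ φ)

/-- The same kernel with values in operators on `ℂ`. -/
def cohKernel : Matrix L L (ℂ →L[ℂ] ℂ) :=
  Matrix.of fun φ ξ => S.cohScalar φ ξ • ContinuousLinearMap.id ℂ ℂ

open scoped ComplexOrder in
theorem herm_posSemidef : (Matrix.of fun i j => S.herm i j : Matrix L L ℂ).PosSemidef := by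
  refine ⟨?_, fun x => ?_⟩
  · ext i j
    simp [Matrix.conjTranspose_apply, S.herm_conj]
  · have h : (x.sum fun i xi => x.sum fun j xj =>
        star xi * (Matrix.of fun i j => S.herm i j : Matrix L L ℂ) i j * xj)
        = S.herm (∑ i ∈ x.support, S.cmul (x i) i) (∑ j ∈ x.support, S.cmul (x j) j) := by
      rw [herm_sum_left]
      refine Finset.sum_congr rfl fun i _ => ?_
      rw [herm_sum_right]
      refine Finset.sum_congr rfl fun j _ => ?_
      rw [herm_cmul_left, herm_cmul_right]
      simp only [Matrix.of_apply, Complex.star_def]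
      ring
    rw [h, herm_self]
    exact_mod_cast S.herm_self_re_nonneg _

open scoped ComplexOrder in
theorem herm_pow_posSemidef (n : ℕ) :
    (Matrix.of fun i j => S.herm i j ^ n : Matrix L L ℂ).PosSemidef := by
  induction n with
  | zero =>
    refine ⟨by ext i j; simp [Matrix.conjTranspose_apply], fun x => ?_⟩
    have h : (x.sum fun i xi => x.sum fun j xj =>
        star xi * (Matrix.of fun i j => S.herm i j ^ 0 : Matrix L L ℂ) i j * xj)
        = star (∑ i ∈ x.support, x i) * ∑ j ∈ x.support, x j := by
      rw [star_sum, Finset.sum_mul_sum]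
      simp [Finsupp.sum]
    rw [h]
    exact star_mul_self_nonneg _
  | succ n ih =>
    have h := ih.hadamard S.herm_posSemidef
    have e : (Matrix.of fun i j => S.herm i j ^ (n + 1) : Matrix L L ℂ)
        = Matrix.hadamard (Matrix.of fun i j => S.herm i j ^ n)
          (Matrix.of fun i j => S.herm i j) := by
      ext i j
      simp [Matrix.hadamard_apply, pow_succ]
    rw [e]
    exact h

open scoped ComplexOrder in
theorem exp_herm_nonneg (s : Finset L) (c : L → ℂ) :
    0 ≤ (∑ i ∈ s, ∑ j ∈ s, (starRingEnd ℂ) (c i) * c j *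
      Complex.exp (1 / 2 * S.herm i j)).re := by
  classical
  have hs : HasSum (fun n : ℕ => ∑ i ∈ s, ∑ j ∈ s, (starRingEnd ℂ) (c i) * c j *
      ((1 / 2 * S.herm i j) ^ n / (n.factorial : ℂ)))
      (∑ i ∈ s, ∑ j ∈ s, (starRingEnd ℂ) (c i) * c j * Complex.exp (1 / 2 * S.herm i j)) := by
    refine hasSum_sum fun i _ => hasSum_sum fun j _ => HasSum.mul_left _ ?_
    rw [Complex.exp_eq_exp_ℂ]
    exact NormedSpace.expSeries_div_hasSum_exp (𝔸 := ℂ) _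
  refine (Complex.hasSum_re hs).nonneg fun n => ?_
  have h := (S.herm_pow_posSemidef n).2 (Finsupp.onFinset s (fun i => if i ∈ s then c i else 0)
    (fun i hi => by by_contra h; simp [h] at hi))
  rw [Finsupp.onFinset_sum _ (by simp)] at h
  have e : ∀ i, ((Finsupp.onFinset s (fun i => if i ∈ s then c i else 0)
      (fun i hi => by by_contra h; simp [h] at hi)).sum fun j xj =>
        star (if i ∈ s then c i else 0) *
          (Matrix.of fun i j => S.herm i j ^ n : Matrix L L ℂ) i j * xj)
      = ∑ j ∈ s, star (if i ∈ s then c i else 0) * S.herm i j ^ n *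
          (if j ∈ s then c j else 0) := by
    intro i
    rw [Finsupp.onFinset_sum _ (by simp)]
    rfl
  simp only [e] at h
  have e2 : (∑ i ∈ s, ∑ j ∈ s, (starRingEnd ℂ) (c i) * c j *
      ((1 / 2 * S.herm i j) ^ n / (n.factorial : ℂ)))
      = (((1 / 2) ^ n / (n.factorial : ℝ) : ℝ) : ℂ) *
        ∑ i ∈ s, ∑ j ∈ s, star (if i ∈ s then c i else 0) * S.herm i j ^ n *
          (if j ∈ s then c j else 0) := by
    rw [Finset.mul_sum]
    refine Finset.sum_congr rfl fun i hi => ?_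
    rw [Finset.mul_sum]
    refine Finset.sum_congr rfl fun j hj => ?_
    simp only [hi, hj, if_true, mul_pow, Complex.star_def]
    push_cast
    ring
  rw [e2, Complex.re_ofReal_mul]
  exact mul_nonneg (by positivity) (Complex.nonneg_iff.mp h).1

open scoped ComplexOrder in
instance cohKernel_posSemidef : Fact S.cohKernel.PosSemidef := by
  have key := (RKHS.posSemidef_tfae (K := S.cohKernel)).out 0 2
  refine ⟨key.mpr ⟨?_, fun vv => ?_⟩⟩
  · ext i j
    simp only [Matrix.conjTranspose_apply, cohKernel, Matrix.of_apply, star_smul]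
    simp [cohScalar, ← Complex.exp_conj, S.herm_conj, ← ContinuousLinearMap.one_def, star_one,
      Complex.conj_ofNat]
  · have h := S.exp_herm_nonneg vv.support fun x => (starRingEnd ℂ) (vv x)
    rw [Finset.sum_comm] at h
    refine le_of_le_of_eq h ?_
    simp only [Finsupp.sum, RCLike.re_to_complex]
    congr 1
    refine Finset.sum_congr rfl fun x _ => Finset.sum_congr rfl fun x' _ => ?_
    simp only [cohKernel, cohScalar, Matrix.of_apply, smul_apply,
      ContinuousLinearMap.id_apply, smul_eq_mul, RCLike.inner_apply, map_mul, ← Complex.exp_conj,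
      S.herm_conj, map_div₀, map_one, Complex.conj_ofNat, Complex.conj_conj]
    ring

/-- The Hilbert space of states in the holomorphic representation: the completion of the span of
the coherent states, realised as a Hilbert space of wave functions `L → ℂ`, with reproducing kernel
`⟨K_φ, K_ξ⟩ = exp({ξ, φ} / 2)`. -/
abbrev StateSpace : Type _ := RKHS.OfKernel S.cohKernel

/-- The coherent state `K_ξ`. -/
def coh (ξ : L) : S.StateSpace := RKHS.kerFun S.StateSpace ξ 1

theorem coh_apply (ξ φ : L) : S.coh ξ φ = Complex.exp (1 / 2 * S.herm ξ φ) := by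
  rw [coh, RKHS.kerFun_apply, RKHS.OfKernel.kernel_ofKernel]
  simp [cohKernel, cohScalar]

/-- The reproducing property `ψ(φ) = ⟨K_φ, ψ⟩`. -/
theorem reproducing (φ : L) (ψ : S.StateSpace) : inner ℂ (S.coh φ) ψ = ψ φ := by
  rw [coh, RKHS.kerFun_inner]
  simp

/-! ### The slice region: boundary data and correlation functions of Weyl observables -/

/-- The boundary of the slice region consists of two copies of the hypersurface, the second one with
the opposite orientation: `L × L` with symplectic form `ω ⊕ (-ω)` and complex structure
`J ⊕ (-J)`. -/
def double : KahlerPhaseSpace (L × L) where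
  ω := S.ω.compl₁₂ (LinearMap.fst ℝ L L) (LinearMap.fst ℝ L L)
    - S.ω.compl₁₂ (LinearMap.snd ℝ L L) (LinearMap.snd ℝ L L)
  J := S.J.prodMap (-S.J)
  alt x := by simp [S.alt]
  J_sq x := by ext <;> simp [S.J_sq]
  compat x y := by simp [S.compat]
  pos x hx := by
    have h : ∀ y, 0 ≤ S.ω y (S.J y) := fun y => by
      by_cases hy : y = 0
      · simp [hy]
      · exact (S.pos y hy).le
    simp only [LinearMap.sub_apply, LinearMap.compl₁₂_apply, LinearMap.fst_apply,
      LinearMap.snd_apply, LinearMap.prodMap_apply, LinearMap.neg_apply, map_neg, sub_neg_eq_add]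
    by_cases h1 : x.1 = 0
    · have h2 : x.2 ≠ 0 := fun h2 => hx (Prod.ext h1 h2)
      have := S.pos _ h2
      have := h x.1
      linarith
    · have := S.pos _ h1
      have := h x.2
      linarith

/-- The solutions in the interior of the slice region: the diagonal of `L × L`. -/
def interior : Submodule ℝ (L × L) := LinearMap.range (LinearMap.id.prod LinearMap.id)

/-- The component `ζ^R` in the decomposition `ζ = ζ^R + J ζ^I` with `ζ^R`, `ζ^I` interior
solutions. -/
def partR (ζ : L × L) : L × L := ((1 / 2 : ℝ) • (ζ.1 + ζ.2), (1 / 2 : ℝ) • (ζ.1 + ζ.2))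

/-- The component `ζ^I` in the decomposition `ζ = ζ^R + J ζ^I` with `ζ^R`, `ζ^I` interior
solutions. -/
def partI (ζ : L × L) : L × L :=
  ((1 / 2 : ℝ) • S.J (ζ.2 - ζ.1), (1 / 2 : ℝ) • S.J (ζ.2 - ζ.1))

theorem eq_parts_iff (ζ a b : L × L) :
    (a ∈ interior ∧ b ∈ interior ∧ ζ = a + S.double.J b) ↔ a = partR ζ ∧ b = S.partI ζ := by
  constructor
  · rintro ⟨⟨x, rfl⟩, ⟨y, rfl⟩, rfl⟩
    refine ⟨?_, ?_⟩
    · ext <;> simp [partR, double] <;> module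
    · ext <;> simp [partI, double, S.J_sq] <;> module
  · rintro ⟨rfl, rfl⟩
    refine ⟨⟨_, rfl⟩, ⟨_, rfl⟩, ?_⟩
    ext
    · simp [partR, partI, double, S.J_sq]; module
    · simp [partR, partI, double, S.J_sq]; module

/-- The inclusion of the real boundary data into the complexified ones, `L^ℂ × L^ℂ`. -/
def toCx2 (ζ : L × L) : Cx L × Cx L := (toCx ζ.1, toCx ζ.2)

/-- The complexified interior solution `ζ^R - i ζ^I` determined by boundary data `ζ`. -/
def hat (ζ : L × L) : Cx L × Cx L := toCx2 (partR ζ) - Complex.I • toCx2 (S.partI ζ)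

/-- A slice observable is determined by a function `F` on `L^ℂ`; its value on a field configuration
in the slice region, an element of `L^ℂ × L^ℂ`, is the value of `F` on the average. -/
def onSlice (F : Cx L → ℂ) (x : Cx L × Cx L) : ℂ := F ((1 / 2 : ℂ) • (x.1 + x.2))

/-- The linear slice observable determined by `ξ`. -/
def linObs (ξ φ : Cx L) : ℂ := 2 * S.ωC ξ φ

/-- The Weyl slice observable determined by `ξ`. -/
def weylObs (ξ φ : Cx L) : ℂ := Complex.exp (Complex.I * S.linObs ξ φ)

/-- The complexified symplectic form on the boundary of the slice region. -/
def ωC2 (x y : Cx L × Cx L) : ℂ := S.ωC x.1 y.1 - S.ωC x.2 y.2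

/-- The complexified solutions in the slice region of the equations of motion with the linear
observable determined by `ξ` added to the action as a source. -/
def sourceSolutions (ξ : Cx L) : Set (Cx L × Cx L) :=
  {η | ∀ φ : Cx L, onSlice (S.linObs ξ) (φ, φ) = 2 * S.ωC2 (φ, φ) η}

/-- The polarization on the boundary of the slice region. On the oppositely oriented copy it is the
conjugate one. -/
def boundaryPolarization : Submodule ℂ (Cx L × Cx L) := S.Lplus.prod S.Lminus

/-- The solution with source `ξ` that satisfies the boundary conditions. -/
def vacuumSolution (ξ : Cx L) : Cx L × Cx L := (-S.Pplus ξ, S.Pminus ξ)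

theorem ωC_alt (x : Cx L) : S.ωC x x = 0 := by
  obtain ⟨a, b, rfl⟩ := Cx.exists_re_im x
  simp [ωC, toCx, S.alt, LinearMap.BilinForm.baseChange_tmul, S.skew a b]

theorem ωC_skew (x y : Cx L) : S.ωC x y = -S.ωC y x := by
  have h := S.ωC_alt (x + y)
  simp only [map_add, LinearMap.add_apply, S.ωC_alt, zero_add, add_zero] at h
  linear_combination h

theorem toCx_inj_aux {a : L} (h : ∀ c, S.ω c a = 0) : a = 0 := by
  by_contra ha
  have := S.pos a ha
  rw [S.skew, h] at this
  simp at this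

theorem ωC_nondeg {y : Cx L} (h : ∀ φ, S.ωC φ y = 0) : y = 0 := by
  obtain ⟨a, b, rfl⟩ := Cx.exists_re_im y
  have key : ∀ c, S.ω c a = 0 ∧ S.ω c b = 0 := by
    intro c
    have := h (toCx c)
    simp [ωC, toCx, LinearMap.BilinForm.baseChange_tmul] at this
    have h1 := congrArg Complex.re this
    have h2 := congrArg Complex.im this
    simp at h1 h2
    exact ⟨h1, h2⟩
  rw [S.toCx_inj_aux fun c => (key c).1, S.toCx_inj_aux fun c => (key c).2]
  simp [toCx]

theorem JC_JC (x : Cx L) : S.JC (S.JC x) = -x := by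
  obtain ⟨a, b, rfl⟩ := Cx.exists_re_im x
  simp [JC, toCx, S.J_sq, TensorProduct.tmul_neg]
  abel

theorem mem_Lplus {x : Cx L} : x ∈ S.Lplus ↔ S.JC x = Complex.I • x :=
  Module.End.mem_eigenspace_iff

theorem mem_Lminus {x : Cx L} : x ∈ S.Lminus ↔ S.JC x = -Complex.I • x :=
  Module.End.mem_eigenspace_iff

theorem eq_vacuumSolution_iff (ξ : Cx L) (η : Cx L × Cx L) :
    (η ∈ S.sourceSolutions ξ ∧ η ∈ S.boundaryPolarization) ↔ η = S.vacuumSolution ξ := by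
  have jump : η ∈ S.sourceSolutions ξ ↔ η.2 - η.1 = ξ := by
    constructor
    · intro h
      have : ∀ φ, S.ωC φ (η.2 - η.1 - ξ) = 0 := by
        intro φ
        have h1 := h φ
        simp only [onSlice, linObs, ωC2, ← two_smul ℂ φ, smul_smul] at h1
        norm_num at h1
        rw [map_sub, map_sub, S.ωC_skew φ ξ]
        rw [h1]
        ring
      exact sub_eq_zero.mp (S.ωC_nondeg this)
    · rintro rfl φ
      simp only [onSlice, linObs, ωC2, ← two_smul ℂ φ, smul_smul]
      norm_num
      rw [S.ωC_skew η.2 φ, S.ωC_skew η.1 φ]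
      ring
  rw [jump, boundaryPolarization, Submodule.mem_prod, mem_Lplus, mem_Lminus]
  constructor
  · rintro ⟨rfl, h1, h2⟩
    have hI : Complex.I * Complex.I = -1 := Complex.I_mul_I
    ext1
    · simp only [vacuumSolution, Pplus, map_sub, h1, h2, smul_sub, smul_smul, mul_neg, hI, neg_neg]
      module
    · simp only [vacuumSolution, Pminus, map_sub, h1, h2, smul_sub, smul_smul, mul_neg, hI,
        neg_neg]
      module
  · rintro rfl
    have hI : Complex.I * Complex.I = -1 := Complex.I_mul_I
    refine ⟨?_, ?_, ?_⟩
    · simp only [vacuumSolution, Pplus, Pminus]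
      module
    · simp only [vacuumSolution, Pplus, map_neg, map_smul, map_sub, JC_JC, smul_neg, smul_sub,
        smul_smul]
      match_scalars <;> first
        | ring1
        | linear_combination (1 / 2 : ℂ) * hI
        | linear_combination (-1 / 2 : ℂ) * hI
    · simp only [vacuumSolution, Pminus, map_add, map_smul, JC_JC, smul_neg, smul_add,
        smul_smul]
      match_scalars <;> first
        | ring1
        | linear_combination (1 / 2 : ℂ) * hI
        | linear_combination (-1 / 2 : ℂ) * hI

/-- The amplitude of the slice region on the (unnormalised) coherent state at `ζ`, i.e.
`exp({ζ, ζ} / 4)` times the amplitude of the normalised coherent state. -/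
def amplitude (ζ : L × L) : ℂ :=
  Complex.exp (1 / 4 * S.double.herm ζ ζ) *
    Complex.exp (-(Complex.I / 2) * S.double.g (partR ζ) (S.partI ζ)
      - 1 / 2 * S.double.g (S.partI ζ) (S.partI ζ))

/-- The correlation function of the slice region with the Weyl slice observable `F = exp(i D)`
determined by `ξ`, on the coherent state at `ζ`: the product of the amplitude, of the value of the
observable on the complexified interior solution and of the vacuum correlation function
`exp(i D(η) / 2)`. -/
def weylCorr (ζ : L × L) (ξ : Cx L) : ℂ :=
  S.amplitude ζ * onSlice (S.weylObs ξ) (S.hat ζ) *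
    Complex.exp (Complex.I / 2 * onSlice (S.linObs ξ) (S.vacuumSolution ξ))

/-! ### Correlation functions of general slice observables, generated by Weyl observables -/

/-- The correlation function with the product `D_1 ⋯ D_n` of the linear slice observables determined
by `ξ_1, …, ξ_n`, defined as
`(-i)^n ∂/∂λ_1 ⋯ ∂/∂λ_n` at `λ = 0` of the correlation function with the Weyl observable
`exp(i (λ_1 D_1 + ⋯ + λ_n D_n))`. -/
def prodCorr (ζ : L × L) {n : ℕ} (ξ : Fin n → Cx L) : ℂ :=
  (-Complex.I) ^ n *
    iteratedFDeriv ℝ n (fun t : Fin n → ℝ => S.weylCorr ζ (∑ k, (t k : ℂ) • ξ k)) 0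
      (fun k => Pi.single k 1)

/-- Finitely many modes: a finite-dimensional complex subspace of `(L, J)`. -/
abbrev FiniteModes : Type _ :=
  {V : Submodule ℝ L // FiniteDimensional ℝ V ∧ ∀ x ∈ V, S.J x ∈ V}

/-- The homogeneous component of degree `n` of a holomorphic function. -/
def homComponent (F : Cx L → ℂ) (n : ℕ) (φ : Cx L) : ℂ :=
  (n.factorial : ℂ)⁻¹ * iteratedDeriv n (fun z : ℂ => F (z • φ)) 0

/-- `r` is the correlation function, on the coherent state at `ζ`, with the degree `n` component of
`F` in the modes `V`: that component is a finite linear combination of products of `n` linear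
observables in these modes, and `r` is the linear combination of their correlation functions. -/
def IsHomCorr (F : Cx L → ℂ) (V : S.FiniteModes) (n : ℕ) (ζ : L × L) (r : ℂ) : Prop :=
  ∃ (N : ℕ) (c : Fin N → ℂ) (ξ : Fin N → Fin n → Cx L),
    (∀ j k, ξ j k ∈ V.1.baseChange ℂ) ∧
    (∀ φ ∈ V.1.baseChange ℂ, homComponent F n φ = ∑ j, c j * ∏ k, S.linObs (ξ j k) φ) ∧
    r = ∑ j, c j * S.prodCorr ζ (ξ j)

/-- `r` is the correlation function with `F` in the modes `V`: the sum over the degrees of the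
correlation functions with the homogeneous components. -/
def IsModeCorr (F : Cx L → ℂ) (V : S.FiniteModes) (ζ : L × L) (r : ℂ) : Prop :=
  ∃ s : ℕ → ℂ, (∀ n, S.IsHomCorr F V n ζ (s n)) ∧ HasSum s r

/-- `r` is the correlation function of the slice region with the slice observable `F` on the
coherent state at `ζ`: the limit, along the directed set of all finite sets of modes, of the
correlation functions in these modes. -/
def IsCorr (F : Cx L → ℂ) (ζ : L × L) (r : ℂ) : Prop :=
  ∃ s : S.FiniteModes → ℂ, (∀ᶠ V in Filter.atTop, S.IsModeCorr F V ζ (s V)) ∧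
    Filter.Tendsto s Filter.atTop (nhds r)

/-! ### The operator of a slice observable -/

/-- `T` assigns to every state `ψ` the wave function of `F̂ ψ`, given by
`(F̂ ψ)(φ) = ⟨K_φ, F̂ ψ⟩ = ρ^F(ψ ⊗ ι(K_φ))`. Here `ρ^F( · ⊗ ι(K_φ))` is the correlation function on
the coherent states, extended linearly and continuously to the whole state space. -/
structure IsQuantization (F : Cx L → ℂ) (T : S.StateSpace →ₗ[ℂ] (L → ℂ)) : Prop where
  corr : ∀ τ φ : L, S.IsCorr F (τ, φ) (T (S.coh τ) φ)
  continuous : ∀ φ : L, Continuous fun ψ => T ψ φ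

/-- The possibly unbounded operator on the state space given by `T`, on its maximal domain: all `ψ`
such that the function `T ψ` is the wave function of a state. -/
def toOperator (T : S.StateSpace →ₗ[ℂ] (L → ℂ)) : S.StateSpace →ₗ.[ℂ] S.StateSpace where
  domain :=
    { carrier := {ψ | ∃ χ : S.StateSpace, ∀ φ, χ φ = T ψ φ}
      add_mem' := by
        rintro a b ⟨x, hx⟩ ⟨y, hy⟩
        exact ⟨x + y, fun φ => by simp [hx, hy]⟩
      zero_mem' := ⟨0, fun φ => by simp⟩
      smul_mem' := by
        rintro c a ⟨x, hx⟩
        exact ⟨c • x, fun φ => by simp [hx]⟩ }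
  toFun :=
    { toFun := fun ψ => ψ.2.choose
      map_add' := by
        intro a b
        refine RKHS.ext fun φ => ?_
        have ha := a.2.choose_spec φ
        have hb := b.2.choose_spec φ
        have hab := (a + b).2.choose_spec φ
        simp only [RKHS.coe_add, Pi.add_apply]
        rw [ha, hb, hab]
        simp
      map_smul' := by
        intro c a
        refine RKHS.ext fun φ => ?_
        have ha := a.2.choose_spec φ
        have hca := (c • a).2.choose_spec φ
        simp only [RKHS.coe_smul, Pi.smul_apply, RingHom.id_apply]
        rw [ha, hca]
        simp }

theorem toOperator_apply (T : S.StateSpace →ₗ[ℂ] (L → ℂ)) (ψ : (S.toOperator T).domain) (φ : L) :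
    (S.toOperator T ψ : S.StateSpace) φ = T ψ φ :=
  ψ.2.choose_spec φ

end KahlerPhaseSpace

end

/-!
On finitely many modes the correlation function of a product of linear observables `D_ξ` is a
symmetric multilinear function of the labels `ξ`, and a symmetric tensor is determined by its
homogeneous polynomial; so the correlation function of a linear combination of such products
depends only on the observable it represents. If that observable is `J`-holomorphic, replacing each
`ξ` by `P^- ξ` does not change it. For labels in `L^-` the factor `exp (i/2 D_ξ(η))` of the Weyl
correlation function is `1`, and differentiating what remains gives the amplitude times the value of
the observable at `P^+ φ + P^- τ`, which for a `J`-holomorphic observable is its value at `φ`.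
Summing the Taylor components yields `F(φ) K_τ(φ)`, and density of the coherent states extends this
to all states.

That the Taylor components of `F` are polynomials on finitely many modes is a form of Hartogs'
theorem: `F` is assumed holomorphic only along complex lines. Baire's theorem gives a bidisc on
which `F` is bounded. Around its centre the Taylor coefficients are polynomials in the direction,
and bounding their supremum by their Mahler measure, a geometric mean over a circle, spreads the
bound to every bidisc.
-/

/-! ### Symmetric tensors and homogeneous polynomials -/

section Polynomials

/-- `f` is a polynomial of degree at most `n` on every line. -/
def IsLinePolynomial {R V : Type*} [CommSemiring R] [AddCommMonoid V] [Module R V] (n : ℕ)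
    (f : V → R) : Prop :=
  ∀ a b : V, ∃ p : Polynomial R, p.natDegree ≤ n ∧ ∀ z : R, f (a + z • b) = p.eval z

variable {ι R : Type*} {n : ℕ}

theorem IsLinePolynomial.comp [CommSemiring R] {V W : Type*} [AddCommMonoid V] [Module R V]
    [AddCommMonoid W] [Module R W] {f : V → R} (hf : IsLinePolynomial n f) (g : W →ₗ[R] V) :
    IsLinePolynomial n (f ∘ g) := fun a b => by
  simpa only [Function.comp_apply, map_add, map_smul] using hf (g a) (g b)

theorem exists_perm_comp_eq {κ : Type*} [Fintype κ] {α β : κ → ι}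
    (h : ∑ k, Finsupp.single (α k) 1 = ∑ k, Finsupp.single (β k) 1) :
    ∃ σ : Equiv.Perm κ, β ∘ σ = α := by
  classical
  have hcard (i : ι) : Fintype.card {k // α k = i} = Fintype.card {k // β k = i} := by
    simpa [Finsupp.finsetSum_apply, Finsupp.single_apply, Fintype.card_subtype]
      using DFunLike.congr_fun h i
  exact ⟨Equiv.ofFiberEquiv fun i => Fintype.equivOfCardEq (hcard i),
    funext fun k => Equiv.ofFiberEquiv_map _ k⟩

theorem multilinear_apply_eq_sum_pi [CommSemiring R] {κ N : Type*} [Fintype κ] [Fintype ι]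
    [DecidableEq κ] [DecidableEq ι] [AddCommMonoid N] [Module R N]
    (M : MultilinearMap R (fun _ : κ => ι → R) N) (x : κ → ι → R) :
    M x = ∑ α : κ → ι, (∏ k, x k (α k)) • M fun k => Pi.single (α k) 1 := by
  conv_lhs => rw [show x = fun k => ∑ i, x k i • Pi.single i 1 from
    funext fun k => pi_eq_sum_univ' (x k)]
  simp_rw [M.map_sum, M.map_smul_univ]

theorem prod_linearForm_eq_sum [CommSemiring R] {κ : Type*} [Fintype κ] [DecidableEq κ] [Fintype ι]
    (x : κ → ι → R) :
    ∏ k, ∑ i, MvPolynomial.C (x k i) * MvPolynomial.X i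
      = ∑ α : κ → ι, (∏ k, x k (α k)) •
        MvPolynomial.monomial (∑ k, Finsupp.single (α k) 1) (1 : R) := by
  simp_rw [Finset.prod_univ_sum, Fintype.piFinset_univ, MvPolynomial.monomial_sum_one,
    MvPolynomial.smul_eq_C_mul, Finset.prod_mul_distrib, map_prod]
  rfl

theorem exists_linearMap_prod_linearForm_eq [CommSemiring R] {κ N : Type*} [Fintype κ] [Fintype ι]
    [AddCommMonoid N] [Module R N] (M : MultilinearMap R (fun _ : κ => ι → R) N)
    (hM : ∀ (x : κ → ι → R) (σ : Equiv.Perm κ), M (x ∘ σ) = M x) :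
    ∃ Λ : MvPolynomial ι R →ₗ[R] N, ∀ x : κ → ι → R,
      Λ (∏ k, ∑ i, MvPolynomial.C (x k i) * MvPolynomial.X i) = M x := by
  classical
  let deg (α : κ → ι) : ι →₀ ℕ := ∑ k, Finsupp.single (α k) 1
  let value (α : κ → ι) : N := M fun k => Pi.single (α k) 1
  have hvalue : Function.FactorsThrough value deg := fun α β hαβ => by
    obtain ⟨σ, rfl⟩ := exists_perm_comp_eq hαβ
    exact hM (fun k => Pi.single (β k) 1) σ
  refine ⟨(MvPolynomial.basisMonomials ι R).constr R (Function.extend deg value 0), fun x => ?_⟩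
  rw [prod_linearForm_eq_sum, map_sum, multilinear_apply_eq_sum_pi M]
  refine Finset.sum_congr rfl fun α _ => ?_
  rw [map_smul, ← congrFun (MvPolynomial.coe_basisMonomials ι R) (deg α), Module.Basis.constr_basis,
    hvalue.extend_apply]

theorem sum_symmetric_eq_zero [CommRing R] [IsDomain R] [Infinite R] {κ N ι' : Type*} [Fintype κ]
    [Fintype ι] [AddCommMonoid N] [Module R N] (M : MultilinearMap R (fun _ : κ => ι → R) N)
    (hM : ∀ (x : κ → ι → R) (σ : Equiv.Perm κ), M (x ∘ σ) = M x)
    (s : Finset ι') (c : ι' → R) (x : ι' → κ → ι → R)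
    (h : ∀ y : ι → R, ∑ j ∈ s, c j * ∏ k, ∑ i, x j k i * y i = 0) :
    ∑ j ∈ s, c j • M (x j) = 0 := by
  obtain ⟨Λ, hΛ⟩ := exists_linearMap_prod_linearForm_eq M hM
  have hzero : ∑ j ∈ s, c j • ∏ k, ∑ i, MvPolynomial.C (x j k i) * MvPolynomial.X i
      = (0 : MvPolynomial ι R) :=
    MvPolynomial.funext fun y => by
      simpa [MvPolynomial.smul_eval, map_prod, map_sum] using h y
  simpa only [map_sum, map_smul, hΛ, map_zero] using congrArg Λ hzero

theorem eval_smul_of_isHomogeneous [CommSemiring R] {q : MvPolynomial ι R}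
    (hq : q.IsHomogeneous n) (w : R) (x : ι → R) :
    MvPolynomial.eval (w • x) q = w ^ n * MvPolynomial.eval x q := by
  simp only [MvPolynomial.eval_eq, Finset.mul_sum]
  refine Finset.sum_congr rfl fun m hm => ?_
  simp only [Pi.smul_apply, smul_eq_mul, mul_pow, Finset.prod_mul_distrib,
    Finset.prod_pow_eq_pow_sum, hq.degree_eq_sum_deg_support hm]
  rw [mul_left_comm]

theorem isHomogeneous_of_eval_smul [CommRing R] [IsDomain R] [CharZero R] {q : MvPolynomial ι R}
    (hq : ∀ (w : R) (x : ι → R), MvPolynomial.eval (w • x) q = w ^ n * MvPolynomial.eval x q) :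
    q.IsHomogeneous n := by
  have hsum : ∑ k ∈ Finset.range (q.totalDegree + 1),
      ((2 : R) ^ k - 2 ^ n) • MvPolynomial.homogeneousComponent k q = 0 := by
    refine MvPolynomial.funext fun x => ?_
    have h := hq 2 x
    rw [← MvPolynomial.sum_homogeneousComponent q] at h
    simp only [map_sum, eval_smul_of_isHomogeneous
      (MvPolynomial.homogeneousComponent_isHomogeneous _ q), Finset.mul_sum] at h
    simp only [map_sum, MvPolynomial.smul_eval, sub_mul, Finset.sum_sub_distrib, h, sub_self,
      map_zero]
  intro m hm
  have hcoeff : ((2 : R) ^ m.degree - 2 ^ n) * MvPolynomial.coeff m q = 0 := by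
    have h := congrArg (MvPolynomial.coeff m) hsum
    simp only [MvPolynomial.coeff_sum, MvPolynomial.coeff_smul,
      MvPolynomial.coeff_homogeneousComponent, smul_eq_mul, mul_ite, mul_zero, Finset.sum_ite_eq,
      MvPolynomial.coeff_zero] at h
    have hdeg : m.degree ≤ q.totalDegree :=
      MvPolynomial.le_totalDegree (MvPolynomial.mem_support_iff.mpr hm)
    rwa [if_pos (Finset.mem_range_succ_iff.mpr hdeg)] at h
  have hpow := sub_eq_zero.mp ((mul_eq_zero.mp hcoeff).resolve_right hm)
  exact (DFunLike.congr_fun Finsupp.degree_eq_weight_one m).symm.trans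
    (Nat.pow_right_injective le_rfl (by exact_mod_cast hpow))

theorem exists_sum_prod_of_isHomogeneous [CommSemiring R] {q : MvPolynomial ι R}
    (hq : q.IsHomogeneous n) :
    ∃ (N : ℕ) (c : Fin N → R) (α : Fin N → Fin n → ι),
      ∀ x, MvPolynomial.eval x q = ∑ j, c j * ∏ k, x (α j k) := by
  rw [← MvPolynomial.mem_homogeneousSubmodule, ← MvPolynomial.homogeneousSubmodule_one_pow,
    MvPolynomial.homogeneousSubmodule_one_eq_span_X, Submodule.span_pow,
    Submodule.mem_span_set'] at hq
  obtain ⟨N, c, m, rfl⟩ := hq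
  have hm (j : Fin N) : ∃ α : Fin n → ι, (m j : MvPolynomial ι R) = ∏ k, MvPolynomial.X (α k) := by
    obtain ⟨f, hf⟩ := Set.mem_pow.mp (m j).2
    choose α hα using fun k => (f k).2
    exact ⟨α, by simp only [← hf, hα, List.prod_ofFn]⟩
  choose α hα using hm
  refine ⟨N, c, α, fun x => ?_⟩
  simp [hα, MvPolynomial.smul_eval, map_prod]

theorem exists_mvPolynomial_of_isLinePolynomial [Field R] [CharZero R] {d : ℕ}
    {f : (Fin d → R) → R} (hf : IsLinePolynomial n f) :
    ∃ q : MvPolynomial (Fin d) R, ∀ x, f x = MvPolynomial.eval x q := by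
  induction d with
  | zero => exact ⟨MvPolynomial.C (f 0), fun x => by
      rw [Subsingleton.elim x 0, MvPolynomial.eval_C]⟩
  | succ d ih =>
    have hline (w v : R) (a b : Fin d → R) : ∃ p : Polynomial R, p.natDegree ≤ n ∧
        ∀ z, f (Fin.cons (w + z * v) (a + z • b)) = p.eval z := by
      obtain ⟨p, hp, h⟩ := hf (Fin.cons w a) (Fin.cons v b)
      refine ⟨p, hp, fun z => ?_⟩
      rw [← h z]
      exact congrArg f (funext fun k => Fin.cases (by simp) (by simp) k)
    have hslice (i : ℕ) : IsLinePolynomial n fun y : Fin d → R => f (Fin.cons (i : R) y) :=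
      fun a b => by simpa using hline i 0 a b
    choose q hq using fun i => ih (hslice i)
    let v : ℕ → R := fun i => i
    let nodes := Finset.range (n + 1)
    refine ⟨∑ i ∈ nodes, MvPolynomial.rename Fin.succ (q i) *
      Polynomial.aeval (MvPolynomial.X 0) (Lagrange.basis nodes v i), fun x => ?_⟩
    obtain ⟨p, hp, hfp⟩ : ∃ p : Polynomial R, p.natDegree ≤ n ∧
        ∀ z, f (Fin.cons z (Fin.tail x)) = p.eval z := by
      simpa using hline 0 1 (Fin.tail x) 0
    have hdeg : p.degree < nodes.card := by
      rw [Finset.card_range]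
      exact Polynomial.degree_le_natDegree.trans_lt (by exact_mod_cast Nat.lt_succ_of_le hp)
    rw [← Fin.cons_self_tail x, hfp, Lagrange.eq_interpolate (v := v) Nat.cast_injective.injOn hdeg,
      Lagrange.interpolate_apply, Polynomial.eval_finsetSum, map_sum]
    refine Finset.sum_congr rfl fun i _ => ?_
    have hbasis : MvPolynomial.eval (Fin.cons (x 0) (Fin.tail x))
        (Polynomial.aeval (MvPolynomial.X 0) (Lagrange.basis nodes v i))
          = Polynomial.eval (x 0) (Lagrange.basis nodes v i) := by
      rw [← MvPolynomial.aeval_eq_eval, ← Polynomial.aeval_algHom_apply, MvPolynomial.aeval_X,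
        Fin.cons_zero, Polynomial.coe_aeval_eq_eval]
    rw [map_mul, MvPolynomial.eval_rename, hbasis, Polynomial.eval_mul, Polynomial.eval_C, ← hfp]
    exact congrArg (· * _) (hq i (Fin.tail x))

theorem exists_sum_prod_of_isLinePolynomial [Field R] [CharZero R] {d : ℕ} {f : (Fin d → R) → R}
    (hf : IsLinePolynomial n f) (hom : ∀ (w : R) (x : Fin d → R), f (w • x) = w ^ n * f x) :
    ∃ (N : ℕ) (c : Fin N → R) (α : Fin N → Fin n → Fin d),
      ∀ x, f x = ∑ j, c j * ∏ k, x (α j k) := by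
  obtain ⟨q, hq⟩ := exists_mvPolynomial_of_isLinePolynomial hf
  simp only [hq] at hom ⊢
  exact exists_sum_prod_of_isHomogeneous (isHomogeneous_of_eval_smul hom)

end Polynomials

/-! ### Mahler measure and growth of polynomials -/

section MahlerMeasure

open Polynomial Real Filter Topology

theorem norm_eval_le_mahlerMeasure (p : ℂ[X]) {z : ℂ} (hz : ‖z‖ ≤ 1) :
    ‖p.eval z‖ ≤ 2 ^ p.natDegree * p.mahlerMeasure := by
  rw [eval_eq_sum_range, ← Nat.cast_two, ← Nat.cast_pow, ← Nat.sum_range_choose, Nat.cast_sum,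
    Finset.sum_mul]
  refine norm_sum_le_of_le _ fun k _ => ?_
  rw [norm_mul, norm_pow]
  exact (mul_le_of_le_one_right (norm_nonneg _) (pow_le_one₀ (norm_nonneg _) hz)).trans
    (norm_coeff_le_choose_mul_mahlerMeasure k p)

theorem mahlerMeasure_rpow_le_circleAverage (p : ℂ[X]) {s : ℝ} (hs : 0 < s) :
    p.mahlerMeasure ^ s ≤ circleAverage (fun z => ‖p.eval z‖ ^ s) 0 1 := by
  obtain rfl | hp := eq_or_ne p 0
  · simp [zero_rpow hs.ne', circleAverage_const]
  set G := p.mahlerMeasure ^ s with hG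
  have hM : 0 < p.mahlerMeasure := p.mahlerMeasure_pos_of_ne_zero hp
  have hGpos : 0 < G := rpow_pos_of_pos hM s
  have hcont : Continuous fun z : ℂ => ‖p.eval z‖ ^ s :=
    p.continuous.norm.rpow_const fun _ => Or.inr hs.le
  have hlog : CircleIntegrable (fun z => log ‖p.eval z‖) 0 1 := p.intervalIntegrable_mahlerMeasure
  have hlogG : s * circleAverage (fun z => log ‖p.eval z‖) 0 1 = log G := by
    rw [← logMahlerMeasure_def, logMahlerMeasure_eq_log_MahlerMeasure, hG, log_rpow hM]
  -- The tangent line of `exp` at `log G`, cut off at the zeros of `p`, where `log 0 = 0`.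
  let tangent (z : ℂ) : ℝ :=
    if p.eval z = 0 then 0 else G * (1 - log G) + G * s * log ‖p.eval z‖
  have htangent (z : ℂ) : tangent z ≤ ‖p.eval z‖ ^ s := by
    by_cases hz : p.eval z = 0
    · simp [tangent, hz, zero_rpow hs.ne']
    · have hpos : 0 < ‖p.eval z‖ := norm_pos_iff.mpr hz
      have h := add_one_le_exp (s * log ‖p.eval z‖ - log G)
      rw [exp_sub, exp_log hGpos, le_div_iff₀ hGpos, mul_comm s, exp_mul, exp_log hpos] at h
      simp only [tangent, if_neg hz]
      linarith
  have hae : (fun z => G * (1 - log G) + (G * s) • log ‖p.eval z‖)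
      =ᶠ[codiscreteWithin (Metric.sphere 0 |1|)] tangent := by
    filter_upwards [compl_finite_mem_codiscreteWithin (rootSet_finite p ℂ)] with z hz
    have hz' : p.eval z ≠ 0 := by simpa [mem_rootSet, hp] using hz
    simp only [tangent, if_neg hz', smul_eq_mul]
  have hint : CircleIntegrable (fun z => (G * s) • log ‖p.eval z‖) 0 1 := hlog.const_fun_smul
  calc G = circleAverage (fun z => G * (1 - log G) + (G * s) • log ‖p.eval z‖) 0 1 := by
        rw [circleAverage_fun_add (circleIntegrable_const _ _ _) hint, circleAverage_const,
          circleAverage_fun_smul, smul_eq_mul, mul_assoc, hlogG]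
        ring
    _ = circleAverage tangent 0 1 := circleAverage_congr_codiscreteWithin hae one_ne_zero
    _ ≤ circleAverage (fun z => ‖p.eval z‖ ^ s) 0 1 :=
      circleAverage_mono (((circleIntegrable_const _ _ _).add hint).congr_codiscreteWithin hae)
        (hcont.continuousOn.circleIntegrable zero_le_one) fun z _ => htangent z

theorem tendsto_circleAverage_of_dominated {f : ℕ → ℂ → ℝ} {B : ℝ} {c : ℂ} {R : ℝ}
    (hf : ∀ m, Continuous (f m)) (hB : ∀ᶠ m in atTop, ∀ z ∈ Metric.sphere c |R|, ‖f m z‖ ≤ B)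
    (hlim : ∀ z ∈ Metric.sphere c |R|, Tendsto (f · z) atTop (𝓝 0)) :
    Tendsto (fun m => circleAverage (f m) c R) atTop (𝓝 0) := by
  have h := intervalIntegral.tendsto_integral_filter_of_dominated_convergence
    (μ := MeasureTheory.volume) (a := 0) (b := 2 * π) (F := fun m θ => f m (circleMap c R θ))
    (fun _ => B)
    (.of_forall fun m => ((hf m).comp (continuous_circleMap c R)).aestronglyMeasurable)
    (hB.mono fun m hm => .of_forall fun θ _ => hm _ (circleMap_mem_sphere' c R θ))
    intervalIntegrable_const (.of_forall fun θ _ => hlim _ (circleMap_mem_sphere' c R θ))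
  simpa [circleAverage] using h.const_smul (2 * π)⁻¹

theorem eventually_norm_eval_le_pow {p : ℕ → ℂ[X]} (hdeg : ∀ m, (p m).natDegree ≤ m) {B : ℝ}
    (hB : ∀ᶠ m in atTop, ∀ z : ℂ, ‖z‖ = 1 → ‖(p m).eval z‖ ≤ B ^ m)
    (hdecay : ∀ z : ℂ, ‖z‖ = 1 → ∀ ε > 0, ∀ᶠ m in atTop, ‖(p m).eval z‖ ≤ ε ^ m) {ε : ℝ}
    (hε : 0 < ε) : ∀ᶠ m in atTop, ∀ z : ℂ, ‖z‖ ≤ 1 → ‖(p m).eval z‖ ≤ ε ^ m := by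
  let root (m : ℕ) (z : ℂ) : ℝ := ‖(p m).eval z‖ ^ (m : ℝ)⁻¹
  have hroot {m : ℕ} (hm : m ≠ 0) {z : ℂ} {x : ℝ} (hx : 0 ≤ x) (h : ‖(p m).eval z‖ ≤ x ^ m) :
      root m z ≤ x :=
    (rpow_le_rpow (norm_nonneg _) h (by positivity)).trans_eq (pow_rpow_inv_natCast hx hm)
  have hroot_nonneg (m : ℕ) (z : ℂ) : 0 ≤ root m z := rpow_nonneg (norm_nonneg _) _
  have havg : Tendsto (fun m => circleAverage (root m) 0 1) atTop (𝓝 0) := by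
    refine tendsto_circleAverage_of_dominated (B := |B|)
      (fun m => (p m).continuous.norm.rpow_const fun _ => Or.inr (by positivity)) ?_ fun z hz => ?_
    · filter_upwards [hB, eventually_ne_atTop 0] with m hm hm0 z hz
      rw [norm_of_nonneg (hroot_nonneg m z)]
      refine hroot hm0 (abs_nonneg B) ((hm z (by simpa using hz)).trans ?_)
      rw [← abs_pow]
      exact le_abs_self _
    · refine Metric.tendsto_nhds.mpr fun δ hδ => ?_
      filter_upwards [hdecay z (by simpa using hz) (δ / 2) (half_pos hδ), eventually_ne_atTop 0]
        with m hm hm0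
      rw [dist_zero_right, norm_of_nonneg (hroot_nonneg m z)]
      exact (hroot hm0 (half_pos hδ).le hm).trans_lt (half_lt_self hδ)
  filter_upwards [havg.eventually_le_const (half_pos hε), eventually_ne_atTop 0]
    with m hm hm0 z hz
  have hM : (p m).mahlerMeasure ≤ (ε / 2) ^ m := by
    rw [← rpow_inv_natCast_pow (p m).mahlerMeasure_nonneg hm0]
    gcongr
    · exact rpow_nonneg (p m).mahlerMeasure_nonneg _
    · exact (mahlerMeasure_rpow_le_circleAverage (p m) (by positivity)).trans hm
  calc ‖(p m).eval z‖ ≤ 2 ^ (p m).natDegree * (p m).mahlerMeasure := norm_eval_le_mahlerMeasure _ hz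
    _ ≤ 2 ^ m * (ε / 2) ^ m := by
      gcongr
      · exact (p m).mahlerMeasure_nonneg
      · exact one_le_two
      · exact hdeg m
    _ = ε ^ m := by rw [← mul_pow, mul_div_cancel₀ _ two_ne_zero]

end MahlerMeasure

/-! ### Taylor coefficients along complex lines -/

/-- The `n`-th Taylor coefficient at `c` of `F` in the direction `v`. -/
noncomputable def lineCoeff {V : Type*} [AddCommGroup V] [Module ℂ V] (F : V → ℂ) (c : V) (n : ℕ)
    (v : V) : ℂ :=
  (n.factorial : ℂ)⁻¹ * iteratedDeriv n (fun z : ℂ => F (c + z • v)) 0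

/-- `F` is bounded on the closed bidisc of radius `r` around `c` in the complex plane spanned by
`a` and `b`: local boundedness, read off in two directions because `V` carries no topology. -/
def IsBoundedOnBidisc {V : Type*} [AddCommGroup V] [Module ℂ V] (F : V → ℂ) (c a b : V) (r : ℝ) :
    Prop :=
  ∃ M : ℝ, ∀ s t : ℂ, ‖s‖ ≤ r → ‖t‖ ≤ r → ‖F (c + s • a + t • b)‖ ≤ M

section EntireFunctions

theorem differentiable_of_exists_approx {h : ℂ → ℂ}
    (H : ∀ R : ℝ, 0 ≤ R → ∀ ε > 0, ∃ g : ℂ → ℂ, Differentiable ℂ g ∧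
      ∀ z, ‖z‖ ≤ R → ‖g z - h z‖ ≤ ε) : Differentiable ℂ h := by
  intro z₀
  choose g hg hgh using fun N : ℕ =>
    H (‖z₀‖ + 1) (by positivity) (1 / (N + 1)) Nat.one_div_pos_of_nat
  have hlim : TendstoUniformlyOn g h Filter.atTop (Metric.ball 0 (‖z₀‖ + 1)) := by
    rw [Metric.tendstoUniformlyOn_iff]
    intro ε hε
    filter_upwards [tendsto_one_div_add_atTop_nhds_zero_nat.eventually_lt_const hε] with N hN z hz
    rw [dist_comm, dist_eq_norm]
    exact (hgh N z (mem_ball_zero_iff.mp hz).le).trans_lt hN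
  exact (hlim.tendstoLocallyUniformlyOn.differentiableOn
    (.of_forall fun N => (hg N).differentiableOn) Metric.isOpen_ball).differentiableAt
    (Metric.isOpen_ball.mem_nhds (by simp))

theorem iteratedDeriv_eq_zero_of_growth {h : ℂ → ℂ} (hh : Differentiable ℂ h) {n : ℕ} {C : ℝ}
    (hC : ∀ z : ℂ, 1 ≤ ‖z‖ → ‖h z‖ ≤ C * ‖z‖ ^ n) {k : ℕ} (hk : n < k) :
    iteratedDeriv k h 0 = 0 := by
  have hcauchy (R : ℝ) (hR : 1 ≤ R) :
      ‖iteratedDeriv k h 0‖ ≤ k.factorial * C / R ^ (k - n) := by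
    have hR0 : 0 < R := one_pos.trans_le hR
    refine (Complex.norm_iteratedDeriv_le_of_forall_mem_sphere_norm_le k hR0 hh.diffContOnCl
      (C := C * R ^ n) fun z hz => ?_).trans_eq ?_
    · rw [← mem_sphere_zero_iff_norm.mp hz] at hR ⊢
      exact hC z hR
    · rw [← Nat.sub_add_cancel hk.le, pow_add, Nat.add_sub_cancel]
      field_simp
  have hlim : Filter.Tendsto (fun R : ℝ => k.factorial * C / R ^ (k - n)) Filter.atTop (nhds 0) :=
    tendsto_const_nhds.div_atTop (Filter.tendsto_pow_atTop (Nat.sub_ne_zero_of_lt hk))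
  exact norm_le_zero_iff.mp (ge_of_tendsto hlim (Filter.eventually_atTop.mpr ⟨1, hcauchy⟩))

theorem exists_polynomial_of_growth {h : ℂ → ℂ} (hh : Differentiable ℂ h) {n : ℕ} {C : ℝ}
    (hC : ∀ z : ℂ, 1 ≤ ‖z‖ → ‖h z‖ ≤ C * ‖z‖ ^ n) :
    ∃ p : Polynomial ℂ, p.natDegree ≤ n ∧ ∀ z, h z = p.eval z := by
  refine ⟨∑ k ∈ Finset.range (n + 1),
    Polynomial.monomial k ((k.factorial : ℂ)⁻¹ * iteratedDeriv k h 0), ?_, fun z => ?_⟩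
  · exact Polynomial.natDegree_sum_le_of_forall_le _ _ fun k hk =>
      (Polynomial.natDegree_monomial_le _).trans (Finset.mem_range_succ_iff.mp hk)
  · rw [← (Complex.hasSum_taylorSeries_of_entire hh 0 z).tsum_eq,
      tsum_eq_sum (s := Finset.range (n + 1)) fun k hk => by
        rw [iteratedDeriv_eq_zero_of_growth hh hC (by simpa using hk), smul_zero, smul_zero],
      Polynomial.eval_finsetSum]
    refine Finset.sum_congr rfl fun k _ => ?_
    simp only [sub_zero, smul_eq_mul, Polynomial.eval_monomial]
    ring

theorem norm_taylor_quotient_sub_le {c : ℕ → ℂ} {w y : ℂ} {M ρ : ℝ} (hρ : 0 < ρ)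
    (hc : ∀ k, ‖c k‖ ≤ M / ρ ^ k) (hw0 : w ≠ 0) (hw : ‖w‖ ≤ ρ / 2)
    (hy : HasSum (fun k => w ^ k * c k) y) (n : ℕ) :
    ‖(w ^ n)⁻¹ * (y - ∑ k ∈ Finset.range n, w ^ k * c k) - c n‖ ≤ 2 * M / ρ ^ (n + 1) * ‖w‖ := by
  have hM : 0 ≤ M := by simpa using (norm_nonneg _).trans (hc 0)
  have hratio : ‖w‖ / ρ ≤ 1 / 2 := by rw [div_le_div_iff₀ hρ two_pos]; linarith
  have hterm (k : ℕ) : ‖w ^ (k + (n + 1)) * c (k + (n + 1))‖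
      ≤ ‖w‖ ^ (n + 1) * (M / ρ ^ (n + 1)) * (1 / 2) ^ k := by
    rw [norm_mul, norm_pow]
    calc _ ≤ ‖w‖ ^ (k + (n + 1)) * (M / ρ ^ (k + (n + 1))) := by gcongr; exact hc _
      _ = ‖w‖ ^ (n + 1) * (M / ρ ^ (n + 1)) * (‖w‖ / ρ) ^ k := by
        rw [div_pow]; field_simp; ring
      _ ≤ _ := by gcongr
  have htail : ‖y - ∑ k ∈ Finset.range (n + 1), w ^ k * c k‖
      ≤ ‖w‖ ^ (n + 1) * (M / ρ ^ (n + 1)) * 2 := by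
    rw [← ((hasSum_nat_add_iff' (n + 1)).mpr hy).tsum_eq]
    exact tsum_of_norm_bounded (hasSum_geometric_two.mul_left _) hterm
  have hquot : (w ^ n)⁻¹ * (y - ∑ k ∈ Finset.range n, w ^ k * c k) - c n
      = (w ^ n)⁻¹ * (y - ∑ k ∈ Finset.range (n + 1), w ^ k * c k) := by
    rw [Finset.sum_range_succ]; field_simp; ring
  rw [hquot, norm_mul, norm_inv, norm_pow]
  calc _ ≤ (‖w‖ ^ n)⁻¹ * (‖w‖ ^ (n + 1) * (M / ρ ^ (n + 1)) * 2) := by gcongr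
    _ = _ := by field_simp; ring

end EntireFunctions

section LineCoeff

variable {V : Type*} [AddCommGroup V] [Module ℂ V] {F : V → ℂ} {c a b : V} {r : ℝ}

theorem hasSum_lineCoeff (hF : IsLineHolomorphic F) (c v : V) (w : ℂ) :
    HasSum (fun n => w ^ n * lineCoeff F c n v) (F (c + w • v)) := by
  refine (Complex.hasSum_taylorSeries_of_entire (hF c v) 0 w).congr_fun fun n => ?_
  simp only [lineCoeff, sub_zero, smul_eq_mul]
  ring

theorem lineCoeff_smul (hF : IsLineHolomorphic F) (c v : V) (n : ℕ) (w : ℂ) :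
    lineCoeff F c n (w • v) = w ^ n * lineCoeff F c n v := by
  have h := congrFun (iteratedDeriv_comp_const_mul ((hF c v).contDiff (n := n)) w) 0
  rw [mul_zero] at h
  simp only [lineCoeff, smul_smul, mul_comm _ w]
  rw [h, mul_left_comm]

theorem norm_lineCoeff_le (hF : IsLineHolomorphic F) {v : V} {ρ M : ℝ} (hρ : 0 < ρ)
    (hM : ∀ u : ℂ, ‖u‖ ≤ ρ → ‖F (c + u • v)‖ ≤ M) (n : ℕ) :
    ‖lineCoeff F c n v‖ ≤ M / ρ ^ n := by
  have h := Complex.norm_iteratedDeriv_le_of_forall_mem_sphere_norm_le n hρ (hF c v).diffContOnCl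
    fun z hz => hM z (mem_sphere_zero_iff_norm.mp hz).le
  rw [lineCoeff, norm_mul, norm_inv, Complex.norm_natCast,
    inv_mul_le_iff₀ (by exact_mod_cast n.factorial_pos)]
  exact h.trans_eq (mul_div_assoc _ _ _)

theorem IsBoundedOnBidisc.symm (h : IsBoundedOnBidisc F c a b r) : IsBoundedOnBidisc F c b a r :=
  h.imp fun _ hM s t hs ht => by rw [add_right_comm]; exact hM t s ht hs

theorem IsBoundedOnBidisc.exists_norm_lineCoeff_le (h : IsBoundedOnBidisc F c a b r)
    (hF : IsLineHolomorphic F) (hr : 0 < r) {R : ℝ} (hR : 0 ≤ R) :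
    ∃ M ρ : ℝ, 0 < ρ ∧ ∀ n (z : ℂ), ‖z‖ ≤ R → ‖lineCoeff F c n (a + z • b)‖ ≤ M / ρ ^ n := by
  obtain ⟨M, hM⟩ := h
  have hρ : 0 < r / (1 + R) := by positivity
  have hle : r / (1 + R) ≤ r := div_le_self hr.le (le_add_of_nonneg_right hR)
  refine ⟨M, r / (1 + R), hρ, fun n z hz => norm_lineCoeff_le hF hρ (fun u hu => ?_) n⟩
  rw [smul_add, smul_smul, ← add_assoc]
  refine hM _ _ (hu.trans hle) ?_
  calc ‖u * z‖ ≤ r / (1 + R) * R := by rw [norm_mul]; gcongr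
    _ ≤ r := by rw [div_mul_eq_mul_div, div_le_iff₀ (by positivity)]; nlinarith

theorem IsBoundedOnBidisc.differentiable_lineCoeff (h : IsBoundedOnBidisc F c a b r)
    (hF : IsLineHolomorphic F) (hr : 0 < r) (n : ℕ) :
    Differentiable ℂ fun z : ℂ => lineCoeff F c n (a + z • b) := by
  induction n using Nat.strong_induction_on with
  | _ n ih =>
  -- The lower coefficients are entire, hence so are the Taylor quotients converging to this one.
  refine differentiable_of_exists_approx fun R hR ε hε => ?_
  obtain ⟨M, ρ, hρ, hcoeff⟩ := h.exists_norm_lineCoeff_le hF hr hR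
  obtain ⟨δ, hδ, hδε⟩ := exists_pos_mul_lt hε (2 * M / ρ ^ (n + 1))
  obtain ⟨x, hx, hxδ⟩ := exists_between (lt_min (half_pos hρ) hδ)
  have hM : 0 ≤ M := by simpa using (norm_nonneg _).trans (hcoeff 0 0 (by simpa using hR))
  have hw : ‖(x : ℂ)‖ = x := by rw [Complex.norm_real, Real.norm_of_nonneg hx.le]
  refine ⟨fun z => ((x : ℂ) ^ n)⁻¹ * (F (c + (x : ℂ) • (a + z • b))
    - ∑ k ∈ Finset.range n, (x : ℂ) ^ k * lineCoeff F c k (a + z • b)), ?_, fun z hz => ?_⟩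
  · refine (Differentiable.sub ?_ (Differentiable.fun_sum fun k hk =>
      (ih k (Finset.mem_range.mp hk)).const_mul _)).const_mul _
    have hline (z : ℂ) : c + (x : ℂ) • (a + z • b) = c + (x : ℂ) • a + z • (x : ℂ) • b := by
      rw [smul_add, smul_comm z, add_assoc]
    simpa only [hline] using hF (c + (x : ℂ) • a) ((x : ℂ) • b)
  · calc _ ≤ 2 * M / ρ ^ (n + 1) * ‖(x : ℂ)‖ :=
          norm_taylor_quotient_sub_le hρ (fun k => hcoeff k z hz) (by exact_mod_cast hx.ne')
            (hw.trans_le (hxδ.le.trans (min_le_left _ _))) (hasSum_lineCoeff hF _ _ _) n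
      _ ≤ 2 * M / ρ ^ (n + 1) * δ := by
          rw [hw]
          gcongr
          exact hxδ.le.trans (min_le_right _ _)
      _ ≤ ε := hδε.le

theorem IsBoundedOnBidisc.exists_polynomial_lineCoeff (h : IsBoundedOnBidisc F c a b r)
    (hF : IsLineHolomorphic F) (hr : 0 < r) (n : ℕ) :
    ∃ p : Polynomial ℂ, p.natDegree ≤ n ∧ ∀ z : ℂ, lineCoeff F c n (a + z • b) = p.eval z := by
  obtain ⟨M, ρ, -, hcoeff⟩ := h.symm.exists_norm_lineCoeff_le hF hr zero_le_one
  refine exists_polynomial_of_growth (h.differentiable_lineCoeff hF hr n) (C := M / ρ ^ n)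
    fun z hz => ?_
  have hz0 : z ≠ 0 := norm_pos_iff.mp (one_pos.trans_le hz)
  have hline : a + z • b = z • (b + z⁻¹ • a) := by
    rw [smul_add, smul_inv_smul₀ hz0, add_comm]
  rw [hline, lineCoeff_smul hF, norm_mul, norm_pow, mul_comm]
  gcongr
  exact hcoeff n z⁻¹ (by rw [norm_inv]; exact inv_le_one_of_one_le₀ hz)

end LineCoeff

/-! ### Hartogs' theorem on complex planes -/

section Hartogs

open Filter

variable {V : Type*} [AddCommGroup V] [Module ℂ V] {F : V → ℂ} {c a b : V} {r : ℝ}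

theorem exists_isBoundedOnBidisc (hF : IsLineHolomorphic F) (c a b : V) :
    ∃ (t₀ : ℂ) (r : ℝ), 0 < r ∧ IsBoundedOnBidisc F (c + t₀ • b) a b r := by
  let E : ℕ → Set ℂ := fun M => {t | ∀ s : ℂ, ‖s‖ ≤ 1 → ‖F (c + t • b + s • a)‖ ≤ M}
  have hclosed (M : ℕ) : IsClosed (E M) := by
    simp only [E, Set.ofPred_forall]
    refine isClosed_iInter fun s => isClosed_iInter fun _ => isClosed_le ?_ continuous_const
    simp only [add_right_comm c _ (s • a)]
    exact (hF (c + s • a) b).continuous.norm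
  have hcover : ⋃ M, E M = Set.univ := by
    refine Set.eq_univ_of_forall fun t => Set.mem_iUnion.mpr ?_
    obtain ⟨C, hC⟩ := (isCompact_closedBall (0 : ℂ) 1).exists_bound_of_continuousOn
      (hF (c + t • b) a).continuous.continuousOn
    obtain ⟨M, hM⟩ := exists_nat_ge C
    exact ⟨M, fun s hs => (hC s (mem_closedBall_zero_iff.mpr hs)).trans hM⟩
  obtain ⟨M, t₀, ht₀⟩ := nonempty_interior_of_iUnion_of_closed hclosed hcover
  obtain ⟨ε, hε, hball⟩ :=
    Metric.nhds_basis_closedBall.mem_iff.mp (mem_interior_iff_mem_nhds.mp ht₀)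
  refine ⟨t₀, min 1 ε, by positivity, M, fun s t hs ht => ?_⟩
  have hmem : t₀ + t ∈ E M := hball (by
    rw [mem_closedBall_iff_norm, add_sub_cancel_left]
    exact ht.trans (min_le_right _ _))
  simpa only [add_smul, add_assoc, add_left_comm, add_comm] using
    hmem s (hs.trans (min_le_left _ _))

theorem IsBoundedOnBidisc.eventually_norm_lineCoeff_le_pow (h : IsBoundedOnBidisc F c a b r)
    (hF : IsLineHolomorphic F) (hr : 0 < r) {ε : ℝ} (hε : 0 < ε) :
    ∀ᶠ m in atTop, ∀ z : ℂ, ‖z‖ ≤ 1 → ‖lineCoeff F c m (a + z • b)‖ ≤ ε ^ m := by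
  choose p hdeg hp using h.exists_polynomial_lineCoeff hF hr
  obtain ⟨M, ρ, hρ, hcoeff⟩ := h.exists_norm_lineCoeff_le hF hr zero_le_one
  simp only [hp] at hcoeff ⊢
  refine eventually_norm_eval_le_pow hdeg (B := max 1 M / ρ) ?_ (fun z _ δ hδ => ?_) hε
  · filter_upwards [eventually_ne_atTop 0] with m hm z hz
    rw [div_pow]
    refine (hcoeff m z hz.le).trans ?_
    gcongr
    exact (le_max_right 1 M).trans (le_self_pow₀ (le_max_left 1 M) hm)
  · filter_upwards [(hasSum_lineCoeff hF c (a + z • b) (δ : ℂ)⁻¹).summable.tendsto_atTop_zero.norm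
      |>.eventually_le_const (norm_zero.trans_lt one_pos)] with m hm
    rwa [norm_mul, norm_pow, norm_inv, Complex.norm_real, Real.norm_of_nonneg hδ.le, inv_pow,
      inv_mul_le_iff₀ (by positivity), mul_one, hp] at hm

theorem IsBoundedOnBidisc.exists_bound_on_cone (h : IsBoundedOnBidisc F c a b r)
    (hF : IsLineHolomorphic F) (hr : 0 < r) (ρ : ℝ) :
    ∃ C : ℝ, ∀ s t : ℂ, ‖t‖ ≤ ‖s‖ → ‖s‖ ≤ ρ → ‖F (c + s • a + t • b)‖ ≤ C := by
  obtain ⟨M, δ, _, hcoeff⟩ := h.exists_norm_lineCoeff_le hF hr zero_le_one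
  obtain hρ | hρ := le_or_gt ρ 0
  · refine ⟨‖F c‖, fun s t hts hs => ?_⟩
    obtain rfl : s = 0 := norm_le_zero_iff.mp (hs.trans hρ)
    obtain rfl : t = 0 := norm_le_zero_iff.mp (hts.trans norm_zero.le)
    simp
  obtain ⟨m₀, hm₀⟩ := eventually_atTop.mp
    (h.eventually_norm_lineCoeff_le_pow hF hr (show 0 < 1 / 2 / ρ by positivity))
  let bound (m : ℕ) : ℝ := if m < m₀ then ρ ^ m * (M / δ ^ m) else (1 / 2) ^ m
  have hbound : Summable bound :=
    summable_geometric_two.congr_atTop <| (eventually_ge_atTop m₀).mono fun m hm =>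
      (if_neg hm.not_gt).symm
  refine ⟨∑' m, bound m, fun s t hts hs => ?_⟩
  have hline : c + s • a + t • b = c + s • (a + (t / s) • b) := by
    rw [smul_add, smul_smul, mul_div_cancel_of_imp' fun hs0 => by simpa [hs0] using hts, add_assoc]
  have hz : ‖t / s‖ ≤ 1 := by
    rw [norm_div]
    exact div_le_one_of_le₀ hts (norm_nonneg s)
  rw [hline, ← (hasSum_lineCoeff hF c _ s).tsum_eq]
  refine tsum_of_norm_bounded hbound.hasSum fun m => ?_
  rw [norm_mul, norm_pow]
  simp only [bound]
  split_ifs with hm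
  · gcongr
    exact hcoeff m _ hz
  · calc _ ≤ ρ ^ m * (1 / 2 / ρ) ^ m := by gcongr; exact hm₀ m (not_lt.mp hm) _ hz
      _ = (1 / 2) ^ m := by rw [← mul_pow, mul_div_cancel₀ _ hρ.ne']

theorem IsBoundedOnBidisc.extend (h : IsBoundedOnBidisc F c a b r) (hF : IsLineHolomorphic F)
    (hr : 0 < r) (ρ : ℝ) : IsBoundedOnBidisc F c a b ρ := by
  obtain ⟨C, hC⟩ := h.exists_bound_on_cone hF hr ρ
  obtain ⟨C', hC'⟩ := h.symm.exists_bound_on_cone hF hr ρ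
  refine ⟨max C C', fun s t hs ht => ?_⟩
  obtain hts | hst := le_total ‖t‖ ‖s‖
  · exact (hC s t hts hs).trans (le_max_left _ _)
  · rw [add_right_comm]
    exact (hC' t s hst ht).trans (le_max_right _ _)

theorem isBoundedOnBidisc (hF : IsLineHolomorphic F) (c a b : V) (r : ℝ) :
    IsBoundedOnBidisc F c a b r := by
  obtain ⟨t₀, r₀, hr₀, h⟩ := exists_isBoundedOnBidisc hF c a b
  obtain ⟨M, hM⟩ := h.extend hF hr₀ (r + ‖t₀‖)
  refine ⟨M, fun s t hs ht => ?_⟩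
  have hshift : c + t₀ • b + s • a + (t - t₀) • b = c + s • a + t • b := by
    rw [sub_smul]; abel
  rw [← hshift]
  exact hM s (t - t₀) (hs.trans (le_add_of_nonneg_right (norm_nonneg t₀)))
    ((norm_sub_le t t₀).trans (add_le_add_left ht _))

theorem isLinePolynomial_lineCoeff (hF : IsLineHolomorphic F) (c : V) (n : ℕ) :
    IsLinePolynomial n (lineCoeff F c n) := fun a b =>
  (isBoundedOnBidisc hF c a b 1).exists_polynomial_lineCoeff hF one_pos n

end Hartogs

/-! ### Complexification and polarization -/

section Complexification

variable {L : Type*} [AddCommGroup L] [Module ℝ L]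

theorem toCx_add (x y : L) : toCx (x + y) = toCx x + toCx y :=
  TensorProduct.tmul_add _ _ _

theorem toCx_sub (x y : L) : toCx (x - y) = toCx x - toCx y :=
  TensorProduct.tmul_sub _ _ _

theorem toCx_smul (r : ℝ) (x : L) : toCx (r • x) = (r : ℂ) • toCx x := by
  simp [toCx, TensorProduct.smul_tmul', TensorProduct.tmul_smul]

theorem Cx.exists_re_im_of_mem {V : Submodule ℝ L} {x : Cx L} (hx : x ∈ V.baseChange ℂ) :
    ∃ a ∈ V, ∃ b ∈ V, x = toCx a + Complex.I • toCx b := by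
  obtain ⟨y, hy⟩ := V.toBaseChange_surjective ℂ ⟨x, hx⟩
  obtain rfl : (V.toBaseChange ℂ y : Cx L) = x := congrArg Subtype.val hy
  obtain ⟨a, b, rfl⟩ := Cx.exists_re_im y
  exact ⟨a, a.2, b, b.2, by simp [toCx]⟩

end Complexification

theorem iteratedFDeriv_cexp_comp {E : Type*} [NormedAddCommGroup E] [NormedSpace ℂ E] {n : ℕ}
    (g : E →L[ℂ] ℂ) (x : Fin n → E) :
    iteratedFDeriv ℂ n (Complex.exp ∘ g) 0 x = ∏ k, g (x k) := by
  rw [g.iteratedFDeriv_comp_right (Complex.contDiff_exp (n := n)) 0 le_rfl, map_zero,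
    ContinuousMultilinearMap.compContinuousLinearMap_apply,
    iteratedFDeriv_apply_eq_iteratedDeriv_mul_prod, iteratedDeriv_eq_iterate,
    Complex.iter_deriv_exp, Complex.exp_zero, smul_eq_mul, mul_one]

namespace KahlerPhaseSpace

variable {L : Type*} [AddCommGroup L] [Module ℝ L] (S : KahlerPhaseSpace L)

theorem JC_toCx (x : L) : S.JC (toCx x) = toCx (S.J x) := by
  simp [JC, toCx]

theorem ωC_toCx (x y : L) : S.ωC (toCx x) (toCx y) = S.ω x y := by
  simp [ωC, toCx, LinearMap.BilinForm.baseChange_tmul]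

theorem ω_J_left (x y : L) : S.ω (S.J x) y = -S.ω x (S.J y) := by
  rw [S.skew, S.ω_J_comm]

theorem ωC_JC_left (x y : Cx L) : S.ωC (S.JC x) y = -S.ωC x (S.JC y) := by
  obtain ⟨a, b, rfl⟩ := Cx.exists_re_im x
  obtain ⟨c, d, rfl⟩ := Cx.exists_re_im y
  simp only [map_add, map_smul, LinearMap.add_apply, LinearMap.smul_apply, JC_toCx, ωC_toCx,
    ω_J_left, Complex.ofReal_neg, smul_eq_mul]
  ring

theorem linObs_Pminus_left (x y : Cx L) : S.linObs (S.Pminus x) y = S.linObs x (S.Pplus y) := by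
  simp only [linObs, Pminus, Pplus, map_smul, map_add, LinearMap.smul_apply,
    LinearMap.add_apply, ωC_JC_left, smul_neg, sub_eq_add_neg, map_neg]

theorem Pplus_add_Pminus (x : Cx L) : S.Pplus x + S.Pminus x = x := by
  simp only [Pplus, Pminus]
  module

theorem Pminus_mem_Lminus (x : Cx L) : S.Pminus x ∈ S.Lminus := by
  rw [mem_Lminus]
  simp only [Pminus, map_smul, map_add, JC_JC]
  match_scalars
  · linear_combination (1 / 2 : ℂ) * Complex.I_sq
  · ring

/-! ### Correlation functions of products of linear observables -/

/-- The complexified field configuration `P^+ φ + P^- τ` at which slice observables are evaluated on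
the boundary data `(τ, φ)`, written as the average that `onSlice` takes of `hat`. -/
noncomputable def hatAvg (ζ : L × L) : Cx L := (1 / 2 : ℂ) • ((S.hat ζ).1 + (S.hat ζ).2)

theorem hatAvg_eq (τ φ : L) : S.hatAvg (τ, φ) = S.Pplus (toCx φ) + S.Pminus (toCx τ) := by
  simp only [hatAvg, hat, toCx2, partR, partI, Prod.fst_sub, Prod.snd_sub, Prod.smul_fst,
    Prod.smul_snd, toCx_smul, toCx_add, toCx_sub, map_sub, Pplus, Pminus, JC_toCx]
  push_cast
  module

theorem amplitude_eq_coh (τ φ : L) : S.amplitude (τ, φ) = S.coh τ φ := by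
  rw [coh_apply, amplitude, ← Complex.exp_add]
  congr 1
  apply Complex.ext
  · simp [herm, g, double, partR, partI, S.J_sq, S.alt, S.skew (S.J _) _, S.ω_J_comm φ τ]
    ring
  · simp [herm, g, double, partR, partI, S.J_sq, S.alt, S.skew φ τ]
    ring

theorem weylCorr_eq (ζ : L × L) (ξ : Cx L) :
    S.weylCorr ζ ξ = S.amplitude ζ *
      Complex.exp (Complex.I * S.linObs ξ (S.hatAvg ζ) - 1 / 2 * S.ωC ξ (S.JC ξ)) := by
  have hvacuum : (1 / 2 : ℂ) • ((S.vacuumSolution ξ).1 + (S.vacuumSolution ξ).2)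
      = (Complex.I / 2) • S.JC ξ := by
    simp only [vacuumSolution, Pplus, Pminus]
    module
  rw [weylCorr, mul_assoc, onSlice, weylObs, ← Complex.exp_add, ← hatAvg, onSlice, hvacuum, linObs,
    linObs, map_smul, smul_eq_mul]
  congr 2
  linear_combination (1 / 2 : ℂ) * S.ωC ξ (S.JC ξ) * Complex.I_sq

theorem weylCorr_of_mem_Lminus (ζ : L × L) {ξ : Cx L} (hξ : ξ ∈ S.Lminus) :
    S.weylCorr ζ ξ = S.amplitude ζ * Complex.exp (Complex.I * S.linObs ξ (S.hatAvg ζ)) := by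
  rw [weylCorr_eq, S.mem_Lminus.mp hξ, map_smul, ωC_alt, smul_zero, mul_zero, sub_zero]

section Derivatives

variable {E : Type*} [NormedAddCommGroup E] [NormedSpace ℂ E] {n : ℕ}

theorem contDiff_weylCorr_comp [FiniteDimensional ℂ E] (ζ : L × L) (ℓ : E →ₗ[ℂ] Cx L)
    (m : WithTop ℕ∞) : ContDiff ℂ m fun u => S.weylCorr ζ (ℓ u) := by
  let value : E →L[ℂ] ℂ := LinearMap.toContinuousLinearMap
    ((S.ωC.flip (S.hatAvg ζ)).comp ℓ)
  let form : E →L[ℂ] E →L[ℂ] ℂ :=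
    (S.ωC.compl₁₂ ℓ (S.JC.comp ℓ)).toContinuousBilinearMap
  have h : (fun u => S.weylCorr ζ (ℓ u)) = fun u =>
      S.amplitude ζ * Complex.exp (Complex.I * (2 * value u) - 1 / 2 * form u u) :=
    funext fun u => S.weylCorr_eq ζ (ℓ u)
  rw [h]
  fun_prop

theorem prodCorr_comp [FiniteDimensional ℂ E] (ζ : L × L) (ℓ : E →ₗ[ℂ] Cx L) (x : Fin n → E) :
    S.prodCorr ζ (fun k => ℓ (x k)) =
      (-Complex.I) ^ n * iteratedFDeriv ℂ n (fun u => S.weylCorr ζ (ℓ u)) 0 x := by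
  have hsmooth : ContDiff ℂ n fun u => S.weylCorr ζ (ℓ u) := S.contDiff_weylCorr_comp ζ ℓ n
  let g : (Fin n → ℝ) →L[ℝ] E :=
    LinearMap.toContinuousLinearMap (Fintype.linearCombination ℝ x)
  have hg (t : Fin n → ℝ) : g t = ∑ k, (t k : ℂ) • x k := Fintype.linearCombination_apply ℝ x t
  have hcomp : (fun t : Fin n → ℝ => S.weylCorr ζ (∑ k, (t k : ℂ) • ℓ (x k)))
      = (fun u => S.weylCorr ζ (ℓ u)) ∘ g := by
    funext t
    simp only [Function.comp_apply, hg, map_sum, map_smul]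
  have hsingle : (fun k => g (Pi.single k 1)) = x :=
    funext fun k => (Fintype.linearCombination_apply_single ℝ x k 1).trans (one_smul ℝ _)
  rw [prodCorr, hcomp, g.iteratedFDeriv_comp_right (hsmooth.restrict_scalars ℝ) 0 le_rfl, map_zero,
    ← hsmooth.contDiffAt.restrictScalars_iteratedFDeriv (𝕜 := ℝ)]
  exact congrArg (fun y => (-Complex.I) ^ n *
    iteratedFDeriv ℂ n (fun u => S.weylCorr ζ (ℓ u)) 0 y) hsingle

theorem prodCorr_of_mem_Lminus (ζ : L × L) {ξ : Fin n → Cx L} (hξ : ∀ k, ξ k ∈ S.Lminus) :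
    S.prodCorr ζ ξ = S.amplitude ζ * ∏ k, S.linObs (ξ k) (S.hatAvg ζ) := by
  let ℓ : (Fin n → ℂ) →ₗ[ℂ] Cx L := Fintype.linearCombination ℂ ξ
  have hℓ (u : Fin n → ℂ) : ℓ u ∈ S.Lminus := by
    rw [Fintype.linearCombination_apply]
    exact Submodule.sum_mem _ fun k _ => Submodule.smul_mem _ _ (hξ k)
  have hsingle (k : Fin n) : ℓ (Pi.single k 1) = ξ k :=
    (Fintype.linearCombination_apply_single ℂ ξ k 1).trans (one_smul ℂ _)
  let g : (Fin n → ℂ) →L[ℂ] ℂ := LinearMap.toContinuousLinearMap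
    ((Complex.I * 2) • (S.ωC.flip (S.hatAvg ζ)).comp ℓ)
  have hg (u : Fin n → ℂ) : g u = Complex.I * S.linObs (ℓ u) (S.hatAvg ζ) :=
    mul_assoc _ _ _
  have hcorr : (fun u => S.weylCorr ζ (ℓ u)) = S.amplitude ζ • (Complex.exp ∘ g) :=
    funext fun u => by
      rw [S.weylCorr_of_mem_Lminus ζ (hℓ u), ← hg]
      rfl
  have hexp : ContDiff ℂ n (Complex.exp ∘ g) := Complex.contDiff_exp.comp g.contDiff
  calc S.prodCorr ζ ξ = S.prodCorr ζ fun k => ℓ (Pi.single k 1) := by simp only [hsingle]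
    _ = (-Complex.I) ^ n * (S.amplitude ζ * ∏ k, g (Pi.single k 1)) := by
      rw [prodCorr_comp, hcorr, iteratedFDeriv_const_smul_apply hexp.contDiffAt, smul_apply,
        iteratedFDeriv_cexp_comp, smul_eq_mul]
    _ = (-Complex.I * Complex.I) ^ n *
        (S.amplitude ζ * ∏ k, S.linObs (ξ k) (S.hatAvg ζ)) := by
      simp only [hg, hsingle, Finset.prod_mul_distrib, Finset.prod_const, Finset.card_univ,
        Fintype.card_fin, mul_pow]
      ring
    _ = S.amplitude ζ * ∏ k, S.linObs (ξ k) (S.hatAvg ζ) := by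
      rw [neg_mul, Complex.I_mul_I, neg_neg, one_pow, one_mul]

end Derivatives

end KahlerPhaseSpace

/-! ### Finitely many modes -/

namespace KahlerPhaseSpace

variable {L : Type*} [AddCommGroup L] [Module ℝ L] {S : KahlerPhaseSpace L}

section Modes

variable (V : S.FiniteModes)

theorem finite_modes : Module.Finite ℂ (V.1.baseChange ℂ) := by
  have := V.2.1
  exact Module.Finite.of_surjective _ (V.1.toBaseChange_surjective ℂ)

theorem toCx_mem_modes {x : L} (hx : x ∈ V.1) : toCx x ∈ V.1.baseChange ℂ :=
  Submodule.tmul_mem_baseChange_of_mem _ hx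

theorem JC_mem_modes {x : Cx L} (hx : x ∈ V.1.baseChange ℂ) : S.JC x ∈ V.1.baseChange ℂ := by
  obtain ⟨a, ha, b, hb, rfl⟩ := Cx.exists_re_im_of_mem hx
  rw [map_add, map_smul, JC_toCx, JC_toCx]
  exact Submodule.add_mem _ (toCx_mem_modes V (V.2.2 a ha))
    (Submodule.smul_mem _ _ (toCx_mem_modes V (V.2.2 b hb)))

theorem Pplus_mem_modes {x : Cx L} (hx : x ∈ V.1.baseChange ℂ) : S.Pplus x ∈ V.1.baseChange ℂ :=
  Submodule.smul_mem _ _ (Submodule.sub_mem _ hx (Submodule.smul_mem _ _ (JC_mem_modes V hx)))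

theorem Pminus_mem_modes {x : Cx L} (hx : x ∈ V.1.baseChange ℂ) :
    S.Pminus x ∈ V.1.baseChange ℂ :=
  Submodule.smul_mem _ _ (Submodule.add_mem _ hx (Submodule.smul_mem _ _ (JC_mem_modes V hx)))

theorem hatAvg_mem_modes {τ φ : L} (hτ : τ ∈ V.1) (hφ : φ ∈ V.1) :
    S.hatAvg (τ, φ) ∈ V.1.baseChange ℂ := by
  rw [hatAvg_eq]
  exact Submodule.add_mem _ (Pplus_mem_modes V (toCx_mem_modes V hφ))
    (Pminus_mem_modes V (toCx_mem_modes V hτ))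

theorem eq_zero_of_ω_modes {y : L} (hy : y ∈ V.1) (h : ∀ x ∈ V.1, S.ω x y = 0) : y = 0 := by
  by_contra hne
  have hpos := S.pos y hne
  rw [S.skew, h _ (V.2.2 y hy), neg_zero] at hpos
  exact lt_irrefl _ hpos

theorem eq_zero_of_linObs_modes {φ : Cx L} (hφ : φ ∈ V.1.baseChange ℂ)
    (h : ∀ ξ ∈ V.1.baseChange ℂ, S.linObs ξ φ = 0) : φ = 0 := by
  obtain ⟨a, ha, b, hb, rfl⟩ := Cx.exists_re_im_of_mem hφ
  have hparts (x : L) (hx : x ∈ V.1) : S.ω x a = 0 ∧ S.ω x b = 0 := by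
    have hzero := h (toCx x) (toCx_mem_modes V hx)
    rw [linObs, map_add, map_smul, ωC_toCx, ωC_toCx, mul_eq_zero, or_iff_right two_ne_zero,
      smul_eq_mul, mul_comm] at hzero
    exact ⟨by simpa using congrArg Complex.re hzero, by simpa using congrArg Complex.im hzero⟩
  rw [eq_zero_of_ω_modes V ha fun x hx => (hparts x hx).1,
    eq_zero_of_ω_modes V hb fun x hx => (hparts x hx).2]
  simp [toCx]

theorem exists_dual_coordinates : ∃ (d : ℕ) (ℓ Θ : V.1.baseChange ℂ ≃ₗ[ℂ] (Fin d → ℂ)),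
    ∀ ξ φ : V.1.baseChange ℂ, S.linObs ξ φ = ∑ a, ℓ ξ a * Θ φ a := by
  have := finite_modes V
  let e := Module.finBasis ℂ (V.1.baseChange ℂ)
  let B : LinearMap.BilinForm ℂ (V.1.baseChange ℂ) := (2 : ℂ) • S.ωC.restrict (V.1.baseChange ℂ)
  have hB (ξ φ : V.1.baseChange ℂ) : S.linObs ξ φ = ∑ a, e.equivFun ξ a * B (e a) φ := by
    calc S.linObs ξ φ = B (∑ a, e.equivFun ξ a • e a) φ := by rw [e.sum_equivFun]; rfl
      _ = ∑ a, e.equivFun ξ a * B (e a) φ := by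
        simp only [map_sum, map_smul, LinearMap.sum_apply, LinearMap.smul_apply, smul_eq_mul]
  let Θ : V.1.baseChange ℂ →ₗ[ℂ] (Fin _ → ℂ) := LinearMap.pi fun a => B (e a)
  have hinj : Function.Injective Θ := by
    refine (injective_iff_map_eq_zero Θ).mpr fun φ hφ => Subtype.ext ?_
    refine eq_zero_of_linObs_modes V φ.2 fun ξ hξ => (hB ⟨ξ, hξ⟩ φ).trans ?_
    exact Finset.sum_eq_zero fun a _ => mul_eq_zero_of_right _ (congrFun hφ a)
  exact ⟨_, e.equivFun, LinearEquiv.ofInjectiveOfFinrankEq Θ hinj (by simp), hB⟩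

theorem sum_prodCorr_eq (ζ : L × L) {n : ℕ} {κ κ' : Type*} [Fintype κ] [Fintype κ'] (c : κ → ℂ)
    (c' : κ' → ℂ) (ξ : κ → Fin n → V.1.baseChange ℂ) (ξ' : κ' → Fin n → V.1.baseChange ℂ)
    (h : ∀ φ ∈ V.1.baseChange ℂ,
      ∑ j, c j * ∏ k, S.linObs (ξ j k) φ = ∑ j, c' j * ∏ k, S.linObs (ξ' j k) φ) :
    ∑ j, c j * S.prodCorr ζ (fun k => ξ j k) = ∑ j, c' j * S.prodCorr ζ fun k => ξ' j k := by
  obtain ⟨d, ℓ, Θ, hℓΘ⟩ := exists_dual_coordinates V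
  let g : (Fin d → ℂ) →ₗ[ℂ] Cx L := (V.1.baseChange ℂ).subtype ∘ₗ ℓ.symm.toLinearMap
  have hsmooth := (S.contDiff_weylCorr_comp ζ g ⊤).contDiffAt (x := 0)
  let M := (iteratedFDeriv ℂ n (fun u => S.weylCorr ζ (g u)) 0).toMultilinearMap
  have hcorr (x : Fin n → V.1.baseChange ℂ) :
      S.prodCorr ζ (fun k => x k) = (-Complex.I) ^ n * M fun k => ℓ (x k) := by
    have hg (k : Fin n) : g (ℓ (x k)) = x k := congrArg Subtype.val (ℓ.symm_apply_apply (x k))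
    simp only [← hg]
    exact S.prodCorr_comp ζ g fun k => ℓ (x k)
  have hobs (x : V.1.baseChange ℂ) (y : Fin d → ℂ) :
      ∑ a, ℓ x a * y a = S.linObs x (Θ.symm y) := by
    rw [hℓΘ, LinearEquiv.apply_symm_apply]
  have hzero := sum_symmetric_eq_zero M (fun x σ => hsmooth.iteratedFDeriv_comp_perm x σ)
    Finset.univ (Sum.elim c (-c')) (Sum.elim (fun j k => ℓ (ξ j k)) fun j k => ℓ (ξ' j k))
    fun y => by
      simp only [Fintype.sum_sum_type, Sum.elim_inl, Sum.elim_inr, hobs, Pi.neg_apply, neg_mul,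
        Finset.sum_neg_distrib, h _ (Θ.symm y).2, add_neg_cancel]
  simp only [Fintype.sum_sum_type, Sum.elim_inl, Sum.elim_inr, Pi.neg_apply, smul_eq_mul, neg_mul,
    Finset.sum_neg_distrib] at hzero
  simp only [hcorr, mul_left_comm (_ : ℂ) ((-Complex.I) ^ n), ← Finset.mul_sum]
  rw [add_neg_eq_zero.mp hzero]

theorem homComponent_eq_lineCoeff (F : Cx L → ℂ) : homComponent F = lineCoeff F 0 := by
  funext n φ
  simp only [homComponent, lineCoeff, zero_add]

theorem exists_homComponent_eq_sum_prod_linObs {F : Cx L → ℂ} (hF : IsLineHolomorphic F) (n : ℕ) :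
    ∃ (N : ℕ) (c : Fin N → ℂ) (ξ : Fin N → Fin n → V.1.baseChange ℂ),
      ∀ φ ∈ V.1.baseChange ℂ, homComponent F n φ = ∑ j, c j * ∏ k, S.linObs (ξ j k) φ := by
  obtain ⟨d, ℓ, Θ, hℓΘ⟩ := exists_dual_coordinates V
  have hpoly : IsLinePolynomial n fun y : Fin d → ℂ => lineCoeff F 0 n (Θ.symm y) :=
    (isLinePolynomial_lineCoeff hF 0 n).comp
      ((V.1.baseChange ℂ).subtype ∘ₗ Θ.symm.toLinearMap)
  obtain ⟨N, c, α, h⟩ := exists_sum_prod_of_isLinePolynomial hpoly fun w y => by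
    rw [map_smul]
    exact lineCoeff_smul hF 0 _ n w
  have hcoord (φ : V.1.baseChange ℂ) (a : Fin d) :
      S.linObs (ℓ.symm (Pi.single a 1)) φ = Θ φ a := by
    simp [hℓΘ, Pi.single_apply]
  refine ⟨N, c, fun j k => ℓ.symm (Pi.single (α j k) 1), fun φ hφ => ?_⟩
  have hφ_sum := h (Θ ⟨φ, hφ⟩)
  rw [LinearEquiv.symm_apply_apply] at hφ_sum
  simp only [← hcoord] at hφ_sum
  rw [homComponent_eq_lineCoeff, hφ_sum]

end Modes

/-! ### Correlation functions of `J`-holomorphic observables -/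

/-- Holomorphy of a slice observable with respect to the complex structure `J`: invariance under
translations in `L^-`. -/
def IsJHolomorphic (S : KahlerPhaseSpace L) (F : Cx L → ℂ) : Prop :=
  ∀ φ : Cx L, ∀ ξ ∈ S.Lminus, F φ = F (φ + ξ)

namespace IsJHolomorphic

variable {F : Cx L → ℂ}

theorem apply_Pplus (hF : S.IsJHolomorphic F) (φ : Cx L) : F (S.Pplus φ) = F φ := by
  rw [hF _ _ (S.Pminus_mem_Lminus φ), S.Pplus_add_Pminus]

theorem apply_hatAvg (hF : S.IsJHolomorphic F) (τ φ : L) :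
    F (S.hatAvg (τ, φ)) = F (toCx φ) := by
  rw [hatAvg_eq, ← hF _ _ (S.Pminus_mem_Lminus _), hF.apply_Pplus]

theorem homComponent (hF : S.IsJHolomorphic F) (n : ℕ) :
    S.IsJHolomorphic (KahlerPhaseSpace.homComponent F n) := fun φ ξ hξ => by
  have hline : (fun z : ℂ => F (z • φ)) = fun z : ℂ => F (z • (φ + ξ)) := by
    funext z
    rw [smul_add]
    exact hF _ _ (S.Lminus.smul_mem z hξ)
  rw [KahlerPhaseSpace.homComponent, KahlerPhaseSpace.homComponent, hline]

theorem sum_prodCorr (hF : S.IsJHolomorphic F) (V : S.FiniteModes) {τ φ : L} (hτ : τ ∈ V.1)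
    (hφ : φ ∈ V.1) {n : ℕ} {κ : Type*} [Fintype κ] (c : κ → ℂ)
    (ξ : κ → Fin n → V.1.baseChange ℂ)
    (h : ∀ x ∈ V.1.baseChange ℂ, F x = ∑ j, c j * ∏ k, S.linObs (ξ j k) x) :
    ∑ j, c j * S.prodCorr (τ, φ) (fun k => ξ j k) = F (toCx φ) * S.coh τ φ := by
  have hPminus (x : Cx L) (hx : x ∈ V.1.baseChange ℂ) :
      F x = ∑ j, c j * ∏ k, S.linObs (S.Pminus (ξ j k)) x := by
    simp only [linObs_Pminus_left]
    rw [← h _ (Pplus_mem_modes V hx), hF.apply_Pplus]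
  calc ∑ j, c j * S.prodCorr (τ, φ) (fun k => ξ j k)
      = ∑ j, c j * S.prodCorr (τ, φ) fun k => S.Pminus (ξ j k) :=
        sum_prodCorr_eq V (τ, φ) c c ξ (fun j k => ⟨_, Pminus_mem_modes V (ξ j k).2⟩)
          fun x hx => (h x hx).symm.trans (hPminus x hx)
    _ = ∑ j, S.amplitude (τ, φ) *
        (c j * ∏ k, S.linObs (S.Pminus (ξ j k)) (S.hatAvg (τ, φ))) := by
      simp only [prodCorr_of_mem_Lminus _ _ fun _ => S.Pminus_mem_Lminus _, mul_left_comm]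
    _ = F (toCx φ) * S.coh τ φ := by
      rw [← Finset.mul_sum, ← hPminus _ (hatAvg_mem_modes V hτ hφ), hF.apply_hatAvg,
        amplitude_eq_coh, mul_comm]

end IsJHolomorphic

section Correlations

variable {F : Cx L → ℂ}

theorem isHomCorr_iff (hF : IsLineHolomorphic F) (hJ : S.IsJHolomorphic F) (V : S.FiniteModes)
    {τ φ : L} (hτ : τ ∈ V.1) (hφ : φ ∈ V.1) (n : ℕ) (r : ℂ) :
    S.IsHomCorr F V n (τ, φ) r ↔ r = homComponent F n (toCx φ) * S.coh τ φ := by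
  constructor
  · rintro ⟨N, c, ξ, hξ, h, rfl⟩
    exact (hJ.homComponent n).sum_prodCorr V hτ hφ c (fun j k => ⟨ξ j k, hξ j k⟩) h
  · rintro rfl
    obtain ⟨N, c, ξ, h⟩ := exists_homComponent_eq_sum_prod_linObs V hF n
    exact ⟨N, c, fun j k => ξ j k, fun j k => (ξ j k).2, h,
      ((hJ.homComponent n).sum_prodCorr V hτ hφ c ξ h).symm⟩

theorem isModeCorr_iff (hF : IsLineHolomorphic F) (hJ : S.IsJHolomorphic F) (V : S.FiniteModes)
    {τ φ : L} (hτ : τ ∈ V.1) (hφ : φ ∈ V.1) (r : ℂ) :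
    S.IsModeCorr F V (τ, φ) r ↔ r = F (toCx φ) * S.coh τ φ := by
  have hsum : HasSum (fun n => homComponent F n (toCx φ) * S.coh τ φ)
      (F (toCx φ) * S.coh τ φ) := by
    simpa only [one_pow, one_mul, one_smul, zero_add, homComponent_eq_lineCoeff] using
      (hasSum_lineCoeff hF 0 (toCx φ) 1).mul_right (S.coh τ φ)
  simp only [IsModeCorr, isHomCorr_iff hF hJ V hτ hφ, ← funext_iff, exists_eq_left]
  exact ⟨fun h => h.unique hsum, fun h => h ▸ hsum⟩

theorem directed_modes (V W : S.FiniteModes) : ∃ U : S.FiniteModes, V ≤ U ∧ W ≤ U := by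
  have := V.2.1
  have := W.2.1
  refine ⟨⟨V.1 ⊔ W.1, inferInstance, fun x hx => ?_⟩, le_sup_left (a := V.1),
    le_sup_right (b := W.1)⟩
  obtain ⟨a, ha, b, hb, rfl⟩ := Submodule.mem_sup.mp hx
  rw [map_add]
  exact Submodule.add_mem_sup (V.2.2 a ha) (W.2.2 b hb)

theorem exists_modes_mem (x : L) : ∃ V : S.FiniteModes, x ∈ V.1 := by
  refine ⟨⟨Submodule.span ℝ {x, S.J x}, FiniteDimensional.span_of_finite ℝ (by simp),
    fun y hy => ?_⟩, Submodule.subset_span (by simp)⟩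
  obtain ⟨a, b, rfl⟩ := Submodule.mem_span_pair.mp hy
  refine Submodule.mem_span_pair.mpr ⟨-b, a, ?_⟩
  rw [map_add, map_smul, map_smul, S.J_sq]
  module

instance neBot_atTop_modes : (Filter.atTop : Filter S.FiniteModes).NeBot := by
  have : IsDirectedOrder S.FiniteModes := ⟨directed_modes⟩
  have : Nonempty S.FiniteModes := ⟨(exists_modes_mem (S := S) 0).choose⟩
  exact Filter.atTop_neBot

theorem eventually_mem_modes (x : L) : ∀ᶠ V : S.FiniteModes in Filter.atTop, x ∈ V.1 := by
  obtain ⟨V, hV⟩ := exists_modes_mem (S := S) x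
  filter_upwards [Filter.eventually_ge_atTop V] with W hW
  exact hW hV

theorem isCorr_iff (hF : IsLineHolomorphic F) (hJ : S.IsJHolomorphic F) (τ φ : L) (r : ℂ) :
    S.IsCorr F (τ, φ) r ↔ r = F (toCx φ) * S.coh τ φ := by
  constructor
  · rintro ⟨s, hs, hr⟩
    refine tendsto_nhds_unique hr (tendsto_const_nhds.congr' ?_)
    filter_upwards [hs, eventually_mem_modes τ, eventually_mem_modes φ] with V h hτ hφ
    exact ((isModeCorr_iff hF hJ V hτ hφ _).mp h).symm
  · rintro rfl
    refine ⟨fun _ => F (toCx φ) * S.coh τ φ, ?_, tendsto_const_nhds⟩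
    filter_upwards [eventually_mem_modes τ, eventually_mem_modes φ] with V hτ hφ
    exact (isModeCorr_iff hF hJ V hτ hφ _).mpr rfl

end Correlations

/-! ### Quantization -/

theorem eq_of_eq_on_coh {f g : S.StateSpace →L[ℂ] ℂ}
    (h : ∀ τ, f (S.coh τ) = g (S.coh τ)) : f = g := by
  refine ContinuousLinearMap.ext_on (s := {RKHS.kerFun S.StateSpace τ v | (τ) (v)}) ?_ ?_
  · rw [Submodule.dense_iff_topologicalClosure_eq_top]
    exact RKHS.kerFun_dense (H := S.StateSpace)
  · rintro _ ⟨τ, v, rfl⟩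
    have hv : RKHS.kerFun S.StateSpace τ v = v • S.coh τ := by
      rw [coh, ← map_smul, smul_eq_mul, mul_one]
    rw [hv, map_smul, map_smul, h]

/-- Multiplication of the wave functions of states by the restriction of `F` to `L`; the product
need not be the wave function of a state. -/
noncomputable def mulOperator (S : KahlerPhaseSpace L) (F : Cx L → ℂ) :
    S.StateSpace →ₗ[ℂ] (L → ℂ) where
  toFun ψ φ := F (toCx φ) * ψ φ
  map_add' a b := funext fun φ => by simp only [RKHS.coe_add, Pi.add_apply, mul_add]
  map_smul' c a := funext fun φ => by
    simp only [RKHS.coe_smul, Pi.smul_apply, smul_eq_mul, RingHom.id_apply, mul_left_comm]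

theorem continuous_mulOperator_apply (F : Cx L → ℂ) (φ : L) :
    Continuous fun ψ => S.mulOperator F ψ φ :=
  continuous_const.mul (RKHS.continuous_eval φ)

theorem isQuantization_iff {F : Cx L → ℂ} (hF : IsLineHolomorphic F) (hJ : S.IsJHolomorphic F)
    (T : S.StateSpace →ₗ[ℂ] (L → ℂ)) : S.IsQuantization F T ↔ T = S.mulOperator F := by
  constructor
  · intro hT
    refine LinearMap.ext fun ψ => funext fun φ => ?_
    let f : S.StateSpace →L[ℂ] ℂ := ⟨LinearMap.proj φ ∘ₗ T, hT.continuous φ⟩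
    let g : S.StateSpace →L[ℂ] ℂ :=
      ⟨LinearMap.proj φ ∘ₗ S.mulOperator F, continuous_mulOperator_apply F φ⟩
    have hfg : f = g := eq_of_eq_on_coh fun τ => (isCorr_iff hF hJ τ φ _).mp (hT.corr τ φ)
    exact DFunLike.congr_fun hfg ψ
  · rintro rfl
    exact ⟨fun τ φ => (isCorr_iff hF hJ τ φ _).mpr rfl, continuous_mulOperator_apply F⟩

end KahlerPhaseSpace

theorem proposition4p4 {L : Type*} [AddCommGroup L] [Module ℝ L] (S : KahlerPhaseSpace L)
    (F : Cx L → ℂ) (hF : IsLineHolomorphic F)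
    (hinv : ∀ φ : Cx L, ∀ ξ ∈ S.Lminus, F φ = F (φ + ξ)) :
    (∃! T : S.StateSpace →ₗ[ℂ] (L → ℂ), S.IsQuantization F T) ∧
    ∀ T : S.StateSpace →ₗ[ℂ] (L → ℂ), S.IsQuantization F T →
      (∀ (ψ : S.StateSpace) (φ : L), T ψ φ = F (toCx φ) * ψ φ) ∧
      (∀ ψ : S.StateSpace, ψ ∈ (S.toOperator T).domain ↔
        ∃ χ : S.StateSpace, ∀ φ : L, χ φ = F (toCx φ) * ψ φ) ∧
      (∀ (ψ : (S.toOperator T).domain) (φ : L),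
        (S.toOperator T ψ : S.StateSpace) φ = F (toCx φ) * (ψ : S.StateSpace) φ) := by
  have hquant (T : S.StateSpace →ₗ[ℂ] (L → ℂ)) : S.IsQuantization F T ↔ T = S.mulOperator F :=
    KahlerPhaseSpace.isQuantization_iff hF hinv T
  simp only [hquant, existsUnique_eq, forall_eq, true_and]
  exact ⟨fun _ _ => rfl, fun _ => Iff.rfl, fun ψ φ => S.toOperator_apply _ ψ φ⟩
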